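/- Let $n\ge 1$, let $V=\mathbb C^{2n+1}$ with the symmetric bilinear form whose matrix in the canonical basis $(e_1,\dots,e_{2n+1})$ is the anti-diagonal matrix with $1$'s along the anti-diagonal, so that the associated quadratic form is $Q(x)=x_{n+1}^2+2\sum_{i=1}^n x_ix_{2n+2-i}$. Let $G=SO(V)$, let $B$, $B^-$ and $T$ be the subgroups of upper triangular, lower triangular and diagonal matrices in $G$, and let $P_1\subset G$ be the stabilizer of the line $[e_1]$. For $1\le i\le 2n+1$ put $$X_i=\{x\in\mathbb P(V) : Q(x)=0,\ x_{i+1}=\dots=x_{2n+1}=0\},\qquad X^i=\{x\in\mathbb P(V) : Q(x)=0,\ x_1=\dots=x_{i-1}=0\},$$ and extend this notation by $X_0=X^{2n+2}=\emptyset$. These sets are regarded as projective varieties with their reduced structure. The multiplicity of a point on a variety is the Hilbert–Samuel multiplicity of the local ring at this point, and $\operatorname{Sing}$ denotes the set of points whose local ring is not regular. Then: 1. The map $gP_1\mapsto g[e_1]$ is a bijection from $G/P_1$ onto the quadric $\{Q=0\}\subset\mathbb P(V)$. The points $\tau[e_1]$ with $\tau\in N_G(T)$ are exactly the $[e_i]$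 with $1\le i\le 2n+1$ and $i\neq n+1$. For each such $i$, the Schubert variety $\overline{B[e_i]}$ (Zariski closure) equals $X_i$, and the opposite Schubert variety $\overline{B^-[e_i]}$ equals $X^i$. 2. Let $1\le i<n+1$. Then $\operatorname{Sing}X_i=\emptyset$, and every point of $X_i$ has multiplicity $1$ on $X_i$. 3. Let $n+1<i\le 2n+1$. Then $\operatorname{Sing}X_i=X_{2n+1-i}$. A point $x\in X_i$ has multiplicity $2$ on $X_i$ if and only if $x_{2n+2-i}=\dots=x_i=0$, and it has multiplicity $1$ if and only if this condition fails. 4. Let $1\le j<n+1$. Then $\operatorname{Sing}X^j=X^{2n+3-j}$. A point $x\in X^j$ has multiplicity $2$ on $X^j$ if and only if $x_j=\dots=x_{2n+2-j}=0$, and it has multiplicity $1$ if and only if this condition fails. 5. Let $n+1<j\le 2n+1$. Then $\operatorname{Sing}X^j=\emptyset$, and every point of $X^j$ has multiplicity $1$ on $X^j$. 6. For all $i,j\in\{1,\dots,2n+1\}\setminus\{n+1\}$ one has $\operatorname{Sing}X_i\cap\operatorname{Sing}X^j=\emptyset$. -/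

import Mathlib

open scoped LinearAlgebra.Projectivization Matrix

noncomputable section

namespace OddQuadric

/-! ### Multiplicity of a local ring -/

/-- The local ring `R` has Hilbert-Samuel multiplicity `e`: for large `k` the length of
`R / 𝔪 ^ k` is finite and given by a polynomial `P` in `k`, and `e = d! * (leading coefficient)`
where `d` is the degree of `P` (which is the Krull dimension of `R` when `R` is Noetherian). -/
def HasHilbertSamuelMultiplicity (R : Type*) [CommRing R] [IsLocalRing R] (e : ℕ) : Prop :=
  ∃ P : Polynomial ℚ,
    (∀ᶠ k : ℕ in Filter.atTop, ∃ l : ℕ,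
      Module.length R (R ⧸ IsLocalRing.maximalIdeal R ^ k) = (l : ℕ∞) ∧
        P.eval (k : ℚ) = (l : ℚ)) ∧
    (P.natDegree.factorial : ℚ) * P.leadingCoeff = (e : ℚ)

/-! ### Local rings of affine varieties over `ℂ` -/

section Affine

variable {σ : Type*}

/-- The coordinate ring `ℂ[Y] = ℂ[x] / I(Y)` of a subset `Y` of affine space. -/
abbrev CoordRing (Y : Set (σ → ℂ)) : Type _ :=
  MvPolynomial σ ℂ ⧸ MvPolynomial.vanishingIdeal ℂ Y

/-- Evaluation `ℂ[Y] → ℂ` at a point `v` of `Y`. -/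
def evalAt (Y : Set (σ → ℂ)) (v : Y) : CoordRing Y →+* ℂ :=
  Ideal.Quotient.lift (MvPolynomial.vanishingIdeal ℂ Y)
    (MvPolynomial.aeval (v : σ → ℂ) : MvPolynomial σ ℂ →ₐ[ℂ] ℂ).toRingHom
    (fun _ hf => hf v v.2)

/-- The ideal of functions in `ℂ[Y]` that vanish at `v`. -/
def pointIdeal (Y : Set (σ → ℂ)) (v : Y) : Ideal (CoordRing Y) := RingHom.ker (evalAt Y v)

instance (Y : Set (σ → ℂ)) (v : Y) : (pointIdeal Y v).IsPrime :=
  RingHom.ker_isPrime (evalAt Y v)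

/-- The local ring of `Y` at `v`. -/
abbrev AffineLocalRing (Y : Set (σ → ℂ)) (v : Y) : Type _ :=
  Localization.AtPrime (pointIdeal Y v)

end Affine

/-! ### Projective varieties over `ℂ`, as subsets of projective space -/

section Projective

variable {σ : Type*}

/-- Zariski closure in projective space: the common zeros of all homogeneous polynomials that
vanish on `X`. -/
def zariskiClosure (X : Set (ℙ ℂ (σ → ℂ))) : Set (ℙ ℂ (σ → ℂ)) :=
  {p | ∀ (d : ℕ) (f : MvPolynomial σ ℂ), f.IsHomogeneous d →
    (∀ q ∈ X, MvPolynomial.eval q.rep f = 0) → MvPolynomial.eval p.rep f = 0}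

/-- The affine trace of `X` in the chart `x_k ≠ 0`, this chart being identified with the affine
hyperplane `x_k = 1`. -/
def affineTrace (X : Set (ℙ ℂ (σ → ℂ))) (k : σ) : Set (σ → ℂ) :=
  {v | v k = 1 ∧ ∃ h : v ≠ 0, Projectivization.mk ℂ v h ∈ X}

/-- The point of the affine trace of `X` given by a point `p` of `X` with `p_k ≠ 0`. -/
def tracePoint (X : Set (ℙ ℂ (σ → ℂ))) (p : ℙ ℂ (σ → ℂ)) (hp : p ∈ X) (k : σ)
    (hk : p.rep k ≠ 0) : affineTrace X k :=
  ⟨(p.rep k)⁻¹ • p.rep, by simp [hk], by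
    have h : (p.rep k)⁻¹ • p.rep ≠ 0 := smul_ne_zero (inv_ne_zero hk) p.rep_nonzero
    refine ⟨h, ?_⟩
    have e : Projectivization.mk ℂ ((p.rep k)⁻¹ • p.rep) h = p := by
      conv_rhs => rw [← p.mk_rep]
      exact (Projectivization.mk_eq_mk_iff' ℂ _ _ h p.rep_nonzero).2 ⟨(p.rep k)⁻¹, rfl⟩
    rw [e]
    exact hp⟩

/-- The local ring of `X` at `p`, computed in the chart `x_k ≠ 0`. -/
abbrev ProjLocalRing (X : Set (ℙ ℂ (σ → ℂ))) (p : ℙ ℂ (σ → ℂ)) (hp : p ∈ X) (k : σ)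
    (hk : p.rep k ≠ 0) : Type _ :=
  AffineLocalRing (affineTrace X k) (tracePoint X p hp k hk)

/-- The point `p` lies on `X` and has multiplicity `e` on `X`. -/
def HasMultiplicity (X : Set (ℙ ℂ (σ → ℂ))) (p : ℙ ℂ (σ → ℂ)) (e : ℕ) : Prop :=
  ∃ hp : p ∈ X, ∀ (k : σ) (hk : p.rep k ≠ 0),
    HasHilbertSamuelMultiplicity (ProjLocalRing X p hp k hk) e

/-- The point `p` lies on `X` and the local ring of `X` at `p` is regular. -/
def IsSmoothPoint (X : Set (ℙ ℂ (σ → ℂ))) (p : ℙ ℂ (σ → ℂ)) : Prop :=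
  ∃ hp : p ∈ X, ∀ (k : σ) (hk : p.rep k ≠ 0), IsRegularLocalRing (ProjLocalRing X p hp k hk)

/-- The singular locus of `X`. -/
def Sing (X : Set (ℙ ℂ (σ → ℂ))) : Set (ℙ ℂ (σ → ℂ)) :=
  {p | p ∈ X ∧ ¬ IsSmoothPoint X p}

end Projective

/-! ### The group `SO(2n+1)` and the odd quadric

The coordinate `x_i`, `1 ≤ i ≤ 2n+1`, has the index `i - 1` in `Fin (2 * n + 1)`. -/

/-- The projective space of lines in `ℂ^(2n+1)`. -/
abbrev PSpace (n : ℕ) : Type := ℙ ℂ (Fin (2 * n + 1) → ℂ)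

/-- The anti-diagonal matrix with ones along the anti-diagonal. -/
def antiDiag (n : ℕ) : Matrix (Fin (2 * n + 1)) (Fin (2 * n + 1)) ℂ :=
  Matrix.of fun i j => if j = i.rev then 1 else 0

/-- `Q(x) = x_{n+1}^2 + 2 ∑_{i=1}^n x_i x_{2n+2-i}`. -/
def Q (n : ℕ) (x : Fin (2 * n + 1) → ℂ) : ℂ :=
  x ⟨n, by omega⟩ ^ 2 +
    2 * ∑ i : Fin n, x ⟨i, by omega⟩ * x ⟨2 * n - i, by omega⟩

/-- `SO(V)`: the matrices of determinant one that preserve the symmetric bilinear form given by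
the anti-diagonal matrix. -/
def SO (n : ℕ) : Subgroup (Matrix.SpecialLinearGroup (Fin (2 * n + 1)) ℂ) where
  carrier := {g | g.1ᵀ * antiDiag n * g.1 = antiDiag n}
  one_mem' := by simp
  mul_mem' {a b} ha hb := by
    simp only [Set.mem_ofPred_eq] at ha hb ⊢
    calc (a * b).1ᵀ * antiDiag n * (a * b).1
        = b.1ᵀ * (a.1ᵀ * antiDiag n * a.1) * b.1 := by
          simp [Matrix.transpose_mul, Matrix.mul_assoc]
      _ = antiDiag n := by rw [ha, hb]
  inv_mem' {a} ha := by
    simp only [Set.mem_ofPred_eq] at ha ⊢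
    have h : a.1 * (a⁻¹).1 = 1 := by
      have := congrArg Subtype.val (mul_inv_cancel a)
      simpa only [Matrix.SpecialLinearGroup.coe_mul, Matrix.SpecialLinearGroup.coe_one] using this
    have h' : (a⁻¹).1ᵀ * a.1ᵀ = 1 := by rw [← Matrix.transpose_mul, h, Matrix.transpose_one]
    calc (a⁻¹).1ᵀ * antiDiag n * (a⁻¹).1
        = (a⁻¹).1ᵀ * (a.1ᵀ * antiDiag n * a.1) * (a⁻¹).1 := by rw [ha]
      _ = ((a⁻¹).1ᵀ * a.1ᵀ) * antiDiag n * (a.1 * (a⁻¹).1) := by simp only [Matrix.mul_assoc]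
      _ = antiDiag n := by rw [h, h', one_mul, mul_one]

/-- Upper triangular matrices of determinant one. -/
def upperTriangular (n : ℕ) : Subgroup (Matrix.SpecialLinearGroup (Fin (2 * n + 1)) ℂ) where
  carrier := {g | g.1.BlockTriangular id}
  one_mem' := Matrix.blockTriangular_one
  mul_mem' {_ _} ha hb := ha.mul hb
  inv_mem' {a} ha := by
    have h : (a⁻¹).1 = (a.1)⁻¹ := by
      refine (Matrix.inv_eq_left_inv ?_).symm
      have := congrArg Subtype.val (inv_mul_cancel a)
      simpa only [Matrix.SpecialLinearGroup.coe_mul, Matrix.SpecialLinearGroup.coe_one] using this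
    have : Invertible a.1 := Matrix.invertibleOfIsUnitDet a.1 (by simp [a.2])
    simp only [Set.mem_ofPred_eq] at ha ⊢
    rw [h]
    exact Matrix.blockTriangular_inv_of_blockTriangular ha

/-- Lower triangular matrices of determinant one. -/
def lowerTriangular (n : ℕ) : Subgroup (Matrix.SpecialLinearGroup (Fin (2 * n + 1)) ℂ) where
  carrier := {g | g.1ᵀ.BlockTriangular id}
  one_mem' := by simpa using Matrix.blockTriangular_one
  mul_mem' {a b} ha hb := by
    simp only [Set.mem_ofPred_eq, Matrix.SpecialLinearGroup.coe_mul, Matrix.transpose_mul] at *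
    exact hb.mul ha
  inv_mem' {a} ha := by
    have h : (a⁻¹).1ᵀ = (a.1ᵀ)⁻¹ := by
      refine (Matrix.inv_eq_left_inv ?_).symm
      have := congrArg Subtype.val (mul_inv_cancel a)
      rw [← Matrix.transpose_mul]
      simpa only [Matrix.SpecialLinearGroup.coe_mul, Matrix.SpecialLinearGroup.coe_one,
        Matrix.transpose_one] using congrArg Matrix.transpose this
    have : Invertible a.1ᵀ := Matrix.invertibleOfIsUnitDet a.1ᵀ (by simp [a.2])
    simp only [Set.mem_ofPred_eq] at ha ⊢
    rw [h]
    exact Matrix.blockTriangular_inv_of_blockTriangular ha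

/-- The Borel subgroup `B` of upper triangular matrices in `SO(V)`. -/
def borel (n : ℕ) : Subgroup (Matrix.SpecialLinearGroup (Fin (2 * n + 1)) ℂ) :=
  SO n ⊓ upperTriangular n

/-- The opposite Borel subgroup `B⁻` of lower triangular matrices in `SO(V)`. -/
def oppBorel (n : ℕ) : Subgroup (Matrix.SpecialLinearGroup (Fin (2 * n + 1)) ℂ) :=
  SO n ⊓ lowerTriangular n

/-- The maximal torus `T = B ∩ B⁻` of diagonal matrices in `SO(V)`. -/
def torus (n : ℕ) : Subgroup (Matrix.SpecialLinearGroup (Fin (2 * n + 1)) ℂ) :=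
  borel n ⊓ oppBorel n

/-- The point `[e_{k+1}]` of projective space. -/
def basisPoint (n : ℕ) (k : Fin (2 * n + 1)) : PSpace n :=
  Projectivization.mk ℂ (Pi.single k 1) (by simp)

/-- The natural map from `G / P_1`, where `G = SO(V)` and `P_1` is the stabilizer of the line
`[e_1]`, to projective space, `g P_1 ↦ g [e_1]`. -/
def quotientMap (n : ℕ) : SO n ⧸ MulAction.stabilizer (SO n) (basisPoint n 0) → PSpace n :=
  MulAction.ofQuotientStabilizer (SO n) (basisPoint n 0)

/-- The points `e_τ = τ P_1` with `τ` in `N_G(T)`, in projective space. -/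
def torusFixedPoints (n : ℕ) : Set (PSpace n) :=
  {p | ∃ τ ∈ SO n ⊓ Subgroup.normalizer (torus n : Set _), p = τ • basisPoint n 0}

/-- The odd quadric `Q = 0`. -/
def quadric (n : ℕ) : Set (PSpace n) := {p | Q n p.rep = 0}

/-- `X_i = {Q = 0, x_{i+1} = … = x_{2n+1} = 0}`. -/
def X (n i : ℕ) : Set (PSpace n) :=
  {p | p ∈ quadric n ∧ ∀ k : Fin (2 * n + 1), i < (k : ℕ) + 1 → p.rep k = 0}

/-- `X^j = {Q = 0, x_1 = … = x_{j-1} = 0}`. -/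
def Xop (n j : ℕ) : Set (PSpace n) :=
  {p | p ∈ quadric n ∧ ∀ k : Fin (2 * n + 1), (k : ℕ) + 1 < j → p.rep k = 0}

/-- The coordinates `x_a, …, x_b` of `p` all vanish. -/
def CoordsVanish (n a b : ℕ) (p : PSpace n) : Prop :=
  ∀ k : Fin (2 * n + 1), a ≤ (k : ℕ) + 1 → (k : ℕ) + 1 ≤ b → p.rep k = 0

end OddQuadric

end

noncomputable section

namespace OddQuadric

section LocalAlgebra

open MvPolynomial IsLocalRing

/-! ### Length over a ring with residue field the base field -/

/-! Every variety in the statement is the intersection of the quadric with a coordinate subspace,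
`coordSection n I`, where `I` is the set of coordinates allowed to be nonzero. Writing `s.rev` for
the mirror index, `Q` is the sum of the `x s * x s.rev`, so only mirror pairs inside `I` contribute
to its restriction.

If `I` contains no such pair, `Q` restricts to zero and the section is a linear space, hence smooth
of multiplicity one. If `I` contains the three middle indices, the restriction is squarefree in
every chart, so the section is locally a reduced hypersurface. Expanding its equation at a point
`v`, the linear term is the differential of `Q`. It vanishes exactly when `v s = 0` for all `s` in
`I` with `s.rev` in `I`; then the order is two, as the square of the middle variable survives.
Otherwise the order is one.

The algebraic input is that for a hypersurface germ of order `r` the multiplicity is `r`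
(`hasHilbertSamuelMultiplicity_hypersurface`), and that, for `r` equal to 1 or 2, the local ring is
regular exactly when `r = 1` (`isRegularLocalRing_hypersurface_iff`). Squarefreeness and the
Nullstellensatz transfer this to coordinate rings of point sets (`affineLocalRing_hypersurface`).

On the group side, Eichler transformations provide enough triangular elements of `SO n` to sweep out
every isotropic line whose last (or first) nonzero coordinate is the `k`-th from `[e_k]`. Signed
permutation matrices commuting with the reversal move `[e_1]` to each isotropic `[e_k]`. Together
they give transitivity on the quadric. A torus element with distinct eigenvalues shows that the
normalizer yields no further points. Orbit closures are found by joining every point of a section to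
its part `x_k ≠ 0` by an explicit curve (`eval_eq_zero_of_open_part`). -/

theorem length_eq_of_maximalIdeal_smul_eq_bot {k R : Type*} [Field k] [CommRing R] [Algebra k R]
    {m : Ideal R} (hres : ∀ r : R, ∃ c : k, r - algebraMap k R c ∈ m)
    {M : Type*} [AddCommGroup M] [Module R M] [Module k M] [IsScalarTower k R M]
    (hM : ∀ r ∈ m, ∀ x : M, r • x = 0) : Module.length R M = Module.length k M := by
  let e : Submodule R M ≃o Submodule k M :=
    { toFun := Submodule.restrictScalars k
      invFun := fun N =>
        { N with
          smul_mem' := fun r x hx => by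
            obtain ⟨c, hc⟩ := hres r
            have h : r • x = c • x := by
              rw [← sub_eq_zero, ← algebraMap_smul R c x, ← sub_smul]
              exact hM _ hc x
            rw [h]
            exact N.smul_mem c hx }
      left_inv := fun N => by ext; rfl
      right_inv := fun N => by ext; rfl
      map_rel_iff' := Iff.rfl }
  apply WithBot.coe_injective
  rw [Module.coe_length, Module.coe_length, Order.krullDim_eq_of_orderIso e]

/-- Filter `M` by the powers of `m`. On a module killed by `m`, the ring acts through its residue
field `k`, so submodules and subspaces coincide; additivity of length does the rest. This reduces
Hilbert–Samuel lengths to vector space dimensions. -/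
theorem length_eq_of_pow_smul_eq_bot {k R : Type*} [Field k] [CommRing R] [Algebra k R]
    {m : Ideal R} (hres : ∀ r : R, ∃ c : k, r - algebraMap k R c ∈ m) (n : ℕ) :
    ∀ {M : Type*} [AddCommGroup M] [Module R M] [Module k M] [IsScalarTower k R M],
      (m ^ n • (⊤ : Submodule R M) = ⊥) → Module.length R M = Module.length k M := by
  induction n with
  | zero =>
    intro M _ _ _ _ hM
    have : Subsingleton M := by
      rw [pow_zero, Ideal.one_eq_top, Submodule.top_smul] at hM
      exact (Submodule.subsingleton_iff R).1 (subsingleton_of_bot_eq_top hM.symm)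
    rw [Module.length_eq_zero, Module.length_eq_zero]
  | succ n ih =>
    intro M _ _ _ _ hM
    let N : Submodule R M := m • ⊤
    have h1 : Module.length R N = Module.length k N := by
      apply ih
      apply Submodule.map_injective_of_injective N.injective_subtype
      rw [Submodule.map_smul'', Submodule.map_top, Submodule.range_subtype, Submodule.map_bot,
        ← hM, pow_succ, Submodule.mul_smul]
    have h2 : Module.length R (M ⧸ N) = Module.length k (M ⧸ N) := by
      apply length_eq_of_maximalIdeal_smul_eq_bot hres
      intro r hr x
      obtain ⟨x, rfl⟩ := N.mkQ_surjective x
      rw [← map_smul, Submodule.mkQ_apply, Submodule.Quotient.mk_eq_zero]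
      exact Submodule.smul_mem_smul hr trivial
    rw [Module.length_eq_add_of_exact N.subtype N.mkQ N.injective_subtype N.mkQ_surjective
        (LinearMap.exact_subtype_mkQ N), h1, h2]
    exact (Module.length_eq_add_of_exact (N.subtype.restrictScalars k) (N.mkQ.restrictScalars k)
      N.injective_subtype N.mkQ_surjective (LinearMap.exact_subtype_mkQ N)).symm

/-! ### Hilbert functions of hypersurfaces -/

variable {τ : Type*}

theorem exists_finset_finsupp_degree_lt [Fintype τ] (k : ℕ) :
    ∃ s : Finset (τ →₀ ℕ), (∀ d, d ∈ s ↔ d.degree < k) ∧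
      s.card = ∑ i ∈ Finset.range k, Nat.multichoose (Fintype.card τ) i := by
  classical
  refine ⟨(Finset.range k).biUnion fun i => Finset.finsuppAntidiag Finset.univ i, fun d => by
    simp [Finsupp.degree_eq_sum], ?_⟩
  rw [Finset.card_biUnion]
  · simp [Finset.card_finsuppAntidiag_nat_eq_multichoose]
  · intro i _ j _ hij
    refine Finset.disjoint_left.2 fun d hd hd' => ?_
    rw [Finset.mem_finsuppAntidiag] at hd hd'
    exact hij (hd.1.symm.trans hd'.1)

theorem length_quotient_pow_idealOfVars [Fintype τ] (k : ℕ) :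
    Module.length ℂ (MvPolynomial τ ℂ ⧸ idealOfVars τ ℂ ^ k) =
      ((∑ i ∈ Finset.range k, Nat.multichoose (Fintype.card τ) i : ℕ) : ℕ∞) := by
  classical
  obtain ⟨D, hD, hcard⟩ := exists_finset_finsupp_degree_lt (τ := τ) k
  let φ : MvPolynomial τ ℂ →ₗ[ℂ] (D → ℂ) := LinearMap.pi fun d => lcoeff ℂ d.1
  have hφ : Function.Surjective φ := by
    intro c
    refine ⟨∑ d : D, monomial d.1 (c d), ?_⟩
    ext d
    simp only [φ, LinearMap.pi_apply, lcoeff_apply, coeff_sum, coeff_monomial]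
    rw [Finset.sum_eq_single d]
    · simp
    · intro b _ hb
      rw [if_neg fun h => hb (Subtype.ext h)]
    · simp
  have hker : φ.ker = (idealOfVars τ ℂ ^ k).restrictScalars ℂ := by
    ext p
    rw [LinearMap.mem_ker, Submodule.restrictScalars_mem, mem_pow_idealOfVars_iff']
    constructor
    · intro h d hd
      exact congrFun h ⟨d, (hD d).2 hd⟩
    · intro h
      ext d
      exact h d.1 ((hD _).1 d.2)
  have e : (MvPolynomial τ ℂ ⧸ idealOfVars τ ℂ ^ k) ≃ₗ[ℂ] (D → ℂ) :=
    (Submodule.quotEquivOfEq _ _ hker.symm : (MvPolynomial τ ℂ ⧸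
      (idealOfVars τ ℂ ^ k).restrictScalars ℂ) ≃ₗ[ℂ] _).trans
      (φ.quotKerEquivOfSurjective hφ)
  rw [e.length_eq, Module.length_eq_finrank, Module.finrank_fintype_fun_eq_card,
    Fintype.card_coe, hcard]

/-- The order of vanishing at the origin is additive on products, which is borrowed from power
series over a domain. -/
theorem mem_pow_idealOfVars_of_mul_mem {f g : MvPolynomial τ ℂ} {r a : ℕ}
    (hf : f ∉ idealOfVars τ ℂ ^ (r + 1)) (h : f * g ∈ idealOfVars τ ℂ ^ (r + a)) :
    g ∈ idealOfVars τ ℂ ^ a := by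
  have key : ∀ (n : ℕ) (p : MvPolynomial τ ℂ),
      p ∈ idealOfVars τ ℂ ^ n ↔ (n : ℕ∞) ≤ (p : MvPowerSeries τ ℂ).order := by
    intro n p
    rw [mem_pow_idealOfVars_iff']
    constructor
    · intro h
      exact MvPowerSeries.nat_le_order fun d hd => by rw [coeff_coe]; exact h d hd
    · intro h d hd
      rw [← coeff_coe]
      exact MvPowerSeries.coeff_of_lt_order (lt_of_lt_of_le (by exact_mod_cast hd) h)
  rw [key] at *
  rw [coe_mul, MvPowerSeries.order_mul] at h
  push_cast at hf h
  rw [not_le, ENat.lt_add_one_iff (ENat.natCast_ne_top r)] at hf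
  have := h.trans (add_le_add_left hf _)
  exact (ENat.add_le_add_iff_left (ENat.natCast_ne_top r)).1 this

/-- With `S` the polynomial ring, multiplication by `f` gives an exact sequence `0 → S/I^a →
S/I^(r+a) → S/(I^(r+a) + (f)) → 0`. Injectivity on the left is where the order of `f` being exactly
`r` matters. The length is thus the number of monomials of degrees `a, …, a+r-1`. -/
theorem length_quotient_hypersurface [Fintype τ] {f : MvPolynomial τ ℂ} {r : ℕ}
    (hf : f ∈ idealOfVars τ ℂ ^ r) (hf' : f ∉ idealOfVars τ ℂ ^ (r + 1)) (a : ℕ) :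
    Module.length ℂ (MvPolynomial τ ℂ ⧸ (idealOfVars τ ℂ ^ (r + a) ⊔ Ideal.span {f})) =
      ((∑ j ∈ Finset.range r, Nat.multichoose (Fintype.card τ) (a + j) : ℕ) : ℕ∞) := by
  set I := idealOfVars τ ℂ
  let μ : (MvPolynomial τ ℂ ⧸ I ^ a) →ₗ[MvPolynomial τ ℂ] (MvPolynomial τ ℂ ⧸ I ^ (r + a)) :=
    Submodule.mapQ _ _ (LinearMap.mulLeft _ f) fun g hg => by
      rw [Submodule.mem_comap, LinearMap.mulLeft_apply, pow_add]
      exact Ideal.mul_mem_mul hf hg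
  let π : (MvPolynomial τ ℂ ⧸ I ^ (r + a)) →ₗ[MvPolynomial τ ℂ]
      (MvPolynomial τ ℂ ⧸ (I ^ (r + a) ⊔ Ideal.span {f})) :=
    Submodule.mapQ _ _ LinearMap.id fun g hg => Ideal.mem_sup_left hg
  have hμ : Function.Injective μ := by
    rw [← LinearMap.ker_eq_bot, LinearMap.ker_eq_bot']
    intro x hx
    obtain ⟨g, rfl⟩ := Submodule.mkQ_surjective _ x
    rw [Submodule.mkQ_apply, Submodule.mapQ_apply, Submodule.Quotient.mk_eq_zero] at hx
    rw [Submodule.mkQ_apply, Submodule.Quotient.mk_eq_zero]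
    exact mem_pow_idealOfVars_of_mul_mem hf' hx
  have hπ : Function.Surjective π := by
    intro x
    obtain ⟨g, rfl⟩ := Submodule.mkQ_surjective _ x
    exact ⟨Submodule.mkQ _ g, rfl⟩
  have hex : Function.Exact μ π := by
    intro x
    obtain ⟨g, rfl⟩ := Submodule.mkQ_surjective _ x
    rw [Submodule.mkQ_apply, Submodule.mapQ_apply, Submodule.Quotient.mk_eq_zero]
    constructor
    · intro h
      obtain ⟨y, hy, z, hz, hyz⟩ := Submodule.mem_sup.1 h
      obtain ⟨c, rfl⟩ := Ideal.mem_span_singleton'.1 hz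
      refine ⟨Submodule.mkQ _ c, ?_⟩
      rw [Submodule.mkQ_apply, Submodule.mapQ_apply, Submodule.Quotient.eq,
        LinearMap.mulLeft_apply]
      have : f * c - g = -y := by
        rw [LinearMap.id_apply] at hyz
        rw [← hyz]; ring
      rw [this]
      exact neg_mem hy
    · rintro ⟨y, hy⟩
      obtain ⟨c, rfl⟩ := Submodule.mkQ_surjective _ y
      rw [Submodule.mkQ_apply, Submodule.mapQ_apply, Submodule.Quotient.eq,
        LinearMap.mulLeft_apply] at hy
      have : g = f * c - (f * c - g) := by ring
      rw [LinearMap.id_apply, this]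
      exact sub_mem
        (Ideal.mem_sup_right (Ideal.mul_mem_right _ _ (Ideal.mem_span_singleton_self f)))
        (Ideal.mem_sup_left hy)
  have h := Module.length_eq_add_of_exact (μ.restrictScalars ℂ) (π.restrictScalars ℂ) hμ hπ hex
  rw [length_quotient_pow_idealOfVars, length_quotient_pow_idealOfVars, add_comm r a,
    Finset.sum_range_add, Nat.cast_add] at h
  rw [add_comm r a]
  exact (ENat.add_right_injective_of_ne_top (ENat.natCast_ne_top _) h).symm

/-- Each summand is a binomial coefficient, polynomial of degree `N - 1` with leading coefficient
`1/(N-1)!`, and there are `r` of them. -/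
theorem exists_polynomial_sum_multichoose {N : ℕ} (hN : N ≠ 0) {r : ℕ} (hr : r ≠ 0) :
    ∃ P : Polynomial ℚ,
      (∀ a : ℕ, P.eval ((r + a : ℕ) : ℚ) =
        ((∑ j ∈ Finset.range r, Nat.multichoose N (a + j) : ℕ) : ℚ)) ∧
      (P.natDegree.factorial : ℚ) * P.leadingCoeff = r := by
  obtain ⟨n, rfl⟩ := Nat.exists_eq_succ_of_ne_zero hN
  -- The polynomial variable is the exponent `r + a`, so the shift by `j + 1 - r` produces the
  -- rising factorial starting at `a + j + 1`.
  let A : ℕ → Polynomial ℚ := fun j =>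
    (ascPochhammer ℚ n).comp (Polynomial.X + Polynomial.C ((j : ℚ) + 1 - r))
  have hAm : ∀ j, (A j).Monic := fun j =>
    (monic_ascPochhammer ℚ n).comp_X_add_C _
  have hAd : ∀ j, (A j).natDegree = n := fun j => by
    rw [Polynomial.natDegree_comp, ascPochhammer_natDegree, Polynomial.natDegree_X_add_C, mul_one]
  have hfac : ((n.factorial : ℕ) : ℚ) ≠ 0 := by exact_mod_cast n.factorial_ne_zero
  let S : Polynomial ℚ := ∑ j ∈ Finset.range r, A j
  have hcoeff : S.coeff n = r := by
    have : ∀ j ∈ Finset.range r, (A j).coeff n = 1 := fun j _ => by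
      have := (hAm j).coeff_natDegree
      rwa [hAd] at this
    rw [Polynomial.finsetSum_coeff, Finset.sum_congr rfl this]
    simp
  have hSd : S.natDegree = n := by
    apply Polynomial.natDegree_eq_of_le_of_coeff_ne_zero
    · exact Polynomial.natDegree_sum_le_of_forall_le _ _ fun j _ => (hAd j).le
    · rw [hcoeff]; exact_mod_cast hr
  refine ⟨Polynomial.C ((n.factorial : ℚ)⁻¹) * S, ?_, ?_⟩
  · intro a
    rw [Polynomial.eval_mul, Polynomial.eval_C, Polynomial.eval_finsetSum, Finset.mul_sum]
    push_cast
    refine Finset.sum_congr rfl fun j _ => ?_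
    rw [Polynomial.eval_comp]
    have h1 : Polynomial.eval ((r : ℚ) + a) (Polynomial.X + Polynomial.C ((j : ℚ) + 1 - r)) =
        ((a + j + 1 : ℕ) : ℚ) := by
      simp; ring
    rw [h1, ascPochhammer_nat_eq_natCast_ascFactorial, Nat.multichoose_eq,
      Nat.ascFactorial_eq_factorial_mul_choose]
    have h2 : n.succ + (a + j) - 1 = a + j + n := by omega
    rw [h2, ← Nat.choose_symm_add]
    push_cast
    field_simp
  · rw [Polynomial.natDegree_C_mul (inv_ne_zero hfac), hSd, Polynomial.leadingCoeff_mul,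
      Polynomial.leadingCoeff_C, Polynomial.leadingCoeff, hSd, hcoeff]
    field_simp

/-! ### The local ring of a hypersurface at the origin -/

section Localization

variable {A : Type*} [CommRing A] [Algebra ℂ A] {n : Ideal A}

theorem isMaximal_of_residue [n.IsPrime] (hres : ∀ a : A, ∃ c : ℂ, a - algebraMap ℂ A c ∈ n) :
    n.IsMaximal := by
  refine Ideal.isMaximal_iff.2 ⟨(Ideal.ne_top_iff_one n).1 ‹n.IsPrime›.ne_top, ?_⟩
  intro J x hJ hx hxJ
  obtain ⟨c, hc⟩ := hres x
  have hc0 : c ≠ 0 := by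
    rintro rfl
    exact hx (by simpa using hc)
  have h1 : algebraMap ℂ A c ∈ J := by
    have := sub_mem hxJ (hJ hc)
    rwa [sub_sub_cancel] at this
  have h2 := J.mul_mem_left (algebraMap ℂ A c⁻¹) h1
  rwa [← map_mul, inv_mul_cancel₀ hc0, map_one] at h2

theorem residue_localization [n.IsMaximal]
    (hres : ∀ a : A, ∃ c : ℂ, a - algebraMap ℂ A c ∈ n) (x : Localization.AtPrime n) :
    ∃ c : ℂ, x - algebraMap ℂ (Localization.AtPrime n) c ∈
      maximalIdeal (Localization.AtPrime n) := by
  obtain ⟨y, hy⟩ := (IsLocalization.AtPrime.equivQuotMaximalIdeal n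
    (Localization.AtPrime n)).surjective (Ideal.Quotient.mk _ x)
  obtain ⟨a, rfl⟩ := Ideal.Quotient.mk_surjective y
  obtain ⟨c, hc⟩ := hres a
  refine ⟨c, ?_⟩
  rw [IsLocalization.AtPrime.equivQuotMaximalIdeal_apply_mk, Ideal.Quotient.eq] at hy
  have h2 : algebraMap A (Localization.AtPrime n) (a - algebraMap ℂ A c) ∈
      maximalIdeal (Localization.AtPrime n) :=
    (IsLocalization.AtPrime.to_map_mem_maximal_iff _ n _).2 hc
  rw [map_sub, ← IsScalarTower.algebraMap_apply] at h2
  have := sub_mem h2 hy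
  rwa [sub_sub_sub_cancel_left] at this

/-- Localizing at a maximal ideal does not change the quotient by its `k`-th power, and over the
residue field `ℂ` length is dimension. -/
theorem length_localization_quotient_pow [n.IsMaximal]
    (hres : ∀ a : A, ∃ c : ℂ, a - algebraMap ℂ A c ∈ n) (k : ℕ) :
    Module.length (Localization.AtPrime n)
      (Localization.AtPrime n ⧸ maximalIdeal (Localization.AtPrime n) ^ k) =
      Module.length ℂ (A ⧸ n ^ k) := by
  rw [length_eq_of_pow_smul_eq_bot (k := ℂ) (residue_localization hres) k]
  · exact ((IsLocalization.AtPrime.equivQuotMaximalIdealPow n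
      (Localization.AtPrime n) k).toLinearEquiv.restrictScalars ℂ).length_eq.symm
  · rw [eq_bot_iff, Submodule.smul_le]
    intro r hr x _
    obtain ⟨x, rfl⟩ := Ideal.Quotient.mk_surjective x
    rw [Submodule.mem_bot, ← Ideal.Quotient.mk_eq_mk, ← Submodule.Quotient.mk_smul,
      Submodule.Quotient.mk_eq_zero]
    exact Ideal.mul_mem_right _ _ hr

end Localization

/-- Additivity of length along `0 → m/m² → R/m² → R/m → 0`, so the embedding dimension can be read
off from the Hilbert function at 2. -/
theorem finrank_cotangentSpace_add_one {R : Type*} [CommRing R] [IsLocalRing R]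
    [IsNoetherianRing R] {d : ℕ} (h : Module.length R (R ⧸ maximalIdeal R ^ 2) = (d : ℕ∞)) :
    Module.finrank (ResidueField R) (CotangentSpace R) + 1 = d := by
  let m := maximalIdeal R
  have hle : m ^ 2 ≤ m := Ideal.pow_le_self two_ne_zero
  let π : (R ⧸ m ^ 2) →ₗ[R] R ⧸ m := Submodule.factor hle
  have hex : Function.Exact m.cotangentToQuotientSquare π := by
    rw [LinearMap.exact_iff, Ideal.range_cotangentToQuotientSquare]
    ext x
    obtain ⟨x, rfl⟩ := Ideal.Quotient.mk_surjective x
    rw [Submodule.restrictScalars_mem, Ideal.mk_mem_cotangentIdeal, LinearMap.mem_ker]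
    exact Ideal.Quotient.eq_zero_iff_mem
  have h1 := Module.length_eq_add_of_exact m.cotangentToQuotientSquare π
    m.cotangentToQuotientSquare_injective (Submodule.factor_surjective hle) hex
  have h2 : Module.length R (R ⧸ m) = 1 := by
    rw [Module.length_eq_one_iff, isSimpleModule_iff_isCoatom]
    exact (inferInstance : m.IsMaximal).out
  have h3 : Module.length R (CotangentSpace R) =
      Module.finrank (ResidueField R) (CotangentSpace R) := by
    rw [← Module.length_eq_finrank]
    exact Module.length_eq_of_surjective IsLocalRing.residue_surjective
  change _ = Module.length R (CotangentSpace R) + _ at h1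
  rw [h2, h3, h] at h1
  exact_mod_cast h1.symm

section Hypersurface

variable {τ : Type*} {A : Type*} [CommRing A] [Algebra ℂ A] {n : Ideal A}
  {ψ : MvPolynomial τ ℂ →ₐ[ℂ] A}

theorem residue_of_comap_eq (hψ : Function.Surjective ψ) (hn : n.comap ψ = idealOfVars τ ℂ)
    (a : A) : ∃ c : ℂ, a - algebraMap ℂ A c ∈ n := by
  obtain ⟨p, rfl⟩ := hψ a
  refine ⟨p.coeff 0, ?_⟩
  have : p - C (p.coeff 0) ∈ n.comap ψ := by
    rw [hn, ← pow_one (idealOfVars τ ℂ), mem_pow_idealOfVars_iff']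
    intro d hd
    rw [Nat.lt_one_iff, Finsupp.degree_eq_zero_iff] at hd
    simp [hd]
  rw [Ideal.mem_comap, map_sub] at this
  rwa [← AlgHom.commutes ψ]

theorem length_quotient_pow_of_surjective (hψ : Function.Surjective ψ)
    (hn : n.comap ψ = idealOfVars τ ℂ) {f : MvPolynomial τ ℂ}
    (hker : RingHom.ker ψ = Ideal.span {f}) (k : ℕ) :
    Module.length ℂ (A ⧸ n ^ k) =
      Module.length ℂ (MvPolynomial τ ℂ ⧸ (idealOfVars τ ℂ ^ k ⊔ Ideal.span {f})) := by
  let q : MvPolynomial τ ℂ →ₐ[ℂ] A ⧸ n ^ k := (Ideal.Quotient.mkₐ ℂ (n ^ k)).comp ψ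
  have hq : Function.Surjective q := (Ideal.Quotient.mkₐ_surjective ℂ _).comp hψ
  have hk : RingHom.ker q = idealOfVars τ ℂ ^ k ⊔ Ideal.span {f} := by
    have h1 : n = (idealOfVars τ ℂ).map ψ := by
      rw [← hn, Ideal.map_comap_of_surjective ψ hψ]
    have h2 : RingHom.ker q = (n ^ k).comap ψ := by
      ext p
      rw [RingHom.mem_ker, Ideal.mem_comap]
      exact Ideal.Quotient.eq_zero_iff_mem
    rw [h2, h1, ← Ideal.map_pow, Ideal.comap_map_of_surjective ψ hψ, ← hker]
    rfl
  rw [← hk]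
  exact (Ideal.quotientKerAlgEquivOfSurjective hq).toLinearEquiv.length_eq.symm

variable [Fintype τ]

theorem card_ne_zero_of_mem_pow {f : MvPolynomial τ ℂ} {r : ℕ}
    (hr : r ≠ 0) (hf : f ∈ idealOfVars τ ℂ ^ r) (hf' : f ∉ idealOfVars τ ℂ ^ (r + 1)) :
    Fintype.card τ ≠ 0 := by
  rw [Ne, Fintype.card_eq_zero_iff]
  intro h
  have h0 : idealOfVars τ ℂ = ⊥ := by simp [idealOfVars]
  rw [h0] at hf hf'
  apply hf'
  rw [Ideal.bot_pow hr, Ideal.mem_bot] at hf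
  simp [hf]

theorem length_localization_hypersurface [n.IsPrime] (hψ : Function.Surjective ψ)
    (hn : n.comap ψ = idealOfVars τ ℂ) {f : MvPolynomial τ ℂ}
    (hker : RingHom.ker ψ = Ideal.span {f}) {r : ℕ}
    (hf : f ∈ idealOfVars τ ℂ ^ r) (hf' : f ∉ idealOfVars τ ℂ ^ (r + 1)) (a : ℕ) :
    Module.length (Localization.AtPrime n)
      (Localization.AtPrime n ⧸ maximalIdeal (Localization.AtPrime n) ^ (r + a)) =
      ((∑ j ∈ Finset.range r, Nat.multichoose (Fintype.card τ) (a + j) : ℕ) : ℕ∞) := by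
  have hres := residue_of_comap_eq hψ hn
  have : n.IsMaximal := isMaximal_of_residue hres
  rw [length_localization_quotient_pow hres, length_quotient_pow_of_surjective hψ hn hker,
    length_quotient_hypersurface hf hf']

theorem hasHilbertSamuelMultiplicity_hypersurface [n.IsPrime] (hψ : Function.Surjective ψ)
    (hn : n.comap ψ = idealOfVars τ ℂ) {f : MvPolynomial τ ℂ}
    (hker : RingHom.ker ψ = Ideal.span {f}) {r : ℕ} (hr : r ≠ 0)
    (hf : f ∈ idealOfVars τ ℂ ^ r) (hf' : f ∉ idealOfVars τ ℂ ^ (r + 1)) :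
    HasHilbertSamuelMultiplicity (Localization.AtPrime n) r := by
  obtain ⟨P, hP, hlead⟩ := exists_polynomial_sum_multichoose
    (card_ne_zero_of_mem_pow hr hf hf') hr
  refine ⟨P, ?_, hlead⟩
  filter_upwards [Filter.eventually_ge_atTop r] with k hk
  obtain ⟨a, rfl⟩ := Nat.exists_eq_add_of_le hk
  exact ⟨_, length_localization_hypersurface hψ hn hker hf hf' a, hP a⟩

instance isMaximal_idealOfVars {τ : Type*} : (idealOfVars τ ℂ).IsMaximal := by
  have : RingHom.ker (aeval (0 : τ → ℂ) : MvPolynomial τ ℂ →ₐ[ℂ] ℂ) = idealOfVars τ ℂ := by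
    ext p
    rw [RingHom.mem_ker, ← pow_one (idealOfVars τ ℂ), mem_pow_idealOfVars_iff']
    simp [aeval_zero, constantCoeff_eq, Finsupp.degree_eq_zero_iff]
  rw [← this]
  exact RingHom.ker_isMaximal_of_surjective _ fun c => ⟨C c, by simp⟩

/-- The localization of a polynomial ring is regular, so its dimension equals the dimension of the
cotangent space, which counts the variables. -/
theorem height_idealOfVars : (idealOfVars τ ℂ).height = (Fintype.card τ : ℕ∞) := by
  have hreg : IsRegularLocalRing (Localization.AtPrime (idealOfVars τ ℂ)) := inferInstance
  rw [IsRegularLocalRing.iff_finrank_cotangentSpace,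
    IsLocalization.AtPrime.ringKrullDim_eq_height (idealOfVars τ ℂ)] at hreg
  have hres := residue_of_comap_eq (ψ := AlgHom.id ℂ (MvPolynomial τ ℂ))
    Function.surjective_id (n := idealOfVars τ ℂ) rfl
  have h := finrank_cotangentSpace_add_one (d := 1 + Fintype.card τ)
    (R := Localization.AtPrime (idealOfVars τ ℂ)) (by
      rw [length_localization_quotient_pow hres, length_quotient_pow_idealOfVars]
      simp [Finset.sum_range_succ])
  have h' : Module.finrank (ResidueField (Localization.AtPrime (idealOfVars τ ℂ)))
    (CotangentSpace (Localization.AtPrime (idealOfVars τ ℂ))) = Fintype.card τ := by omega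
  rw [h'] at hreg
  exact_mod_cast hreg.symm

/-- A nonzero `f` is a nonzerodivisor, so passing to the quotient lowers the dimension by at least
one; conversely, killing one element lowers the height of the ideal of the origin by at most one. -/
theorem ringKrullDim_localization_hypersurface [n.IsPrime] (hψ : Function.Surjective ψ)
    (hn : n.comap ψ = idealOfVars τ ℂ) {f : MvPolynomial τ ℂ}
    (hker : RingHom.ker ψ = Ideal.span {f}) (hf : f ∈ idealOfVars τ ℂ) (hf0 : f ≠ 0) :
    ringKrullDim (Localization.AtPrime n) + 1 = (Fintype.card τ : ℕ∞) := by
  have hmap : n = (idealOfVars τ ℂ).map ψ := by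
    rw [← hn, Ideal.map_comap_of_surjective ψ hψ]
  obtain ⟨e, he⟩ : ∃ e : (MvPolynomial τ ℂ ⧸ Ideal.span {f}) ≃+* A,
      ∀ p, e (Ideal.Quotient.mk _ p) = ψ p :=
    ⟨(Ideal.quotEquivOfEq hker.symm).trans (RingHom.quotientKerEquivOfSurjective hψ),
      fun p => rfl⟩
  have hen : n.height = ((idealOfVars τ ℂ).map (Ideal.Quotient.mk (Ideal.span {f}))).height := by
    have hcomp : (e : _ →+* A).comp (Ideal.Quotient.mk (Ideal.span {f})) = (ψ : _ →+* A) :=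
      RingHom.ext he
    have h1 := Ideal.map_map (I := idealOfVars τ ℂ) (Ideal.Quotient.mk (Ideal.span {f}))
      (e : _ →+* A)
    rw [hcomp] at h1
    rw [← RingEquiv.height_map e, hmap]
    exact congrArg Ideal.height h1.symm
  rw [IsLocalization.AtPrime.ringKrullDim_eq_height n]
  apply le_antisymm
  · have h1 : (n.height : WithBot ℕ∞) ≤ ringKrullDim A := Ideal.height_le_ringKrullDim_of_ne_top
      ‹n.IsPrime›.ne_top
    have h2 := ringKrullDim_quotient_succ_le_of_nonZeroDivisor (mem_nonZeroDivisors_of_ne_zero hf0)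
    rw [ringKrullDim_eq_of_ringEquiv e, MvPolynomial.ringKrullDim_of_isNoetherianRing,
      ringKrullDim_eq_zero_of_field, zero_add, Nat.card_eq_fintype_card] at h2
    exact (add_le_add_left h1 1).trans h2
  · have h := Ideal.height_le_height_add_one_of_mem hf
    rw [← hen, height_idealOfVars] at h
    exact_mod_cast h

/-- The dimension is `N - 1` for `N` variables. The length of `R/m²` is `N` if `f` has a linear term
and `N + 1` if it starts in degree two, so the cotangent space has dimension `N - 1` or `N`
respectively. -/
theorem isRegularLocalRing_hypersurface_iff [n.IsPrime] (hψ : Function.Surjective ψ)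
    (hn : n.comap ψ = idealOfVars τ ℂ) {f : MvPolynomial τ ℂ}
    (hker : RingHom.ker ψ = Ideal.span {f}) {r : ℕ} (hr : r = 1 ∨ r = 2)
    (hf : f ∈ idealOfVars τ ℂ ^ r) (hf' : f ∉ idealOfVars τ ℂ ^ (r + 1)) :
    IsRegularLocalRing (Localization.AtPrime n) ↔ r = 1 := by
  have : IsNoetherianRing A := isNoetherianRing_of_surjective _ _ ψ.toRingHom hψ
  have hr0 : r ≠ 0 := by omega
  have hf0 : f ≠ 0 := by rintro rfl; exact hf' (zero_mem _)
  have hdim := ringKrullDim_localization_hypersurface hψ hn hker (Ideal.pow_le_self hr0 hf) hf0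
  rw [IsRegularLocalRing.iff_finrank_cotangentSpace]
  have hfin : Module.finrank (ResidueField (Localization.AtPrime n))
      (CotangentSpace (Localization.AtPrime n)) + 1 =
      if r = 1 then Fintype.card τ else Fintype.card τ + 1 := by
    apply finrank_cotangentSpace_add_one
    rcases hr with rfl | rfl
    · have := length_localization_hypersurface hψ hn hker hf hf' 1
      simpa using this
    · have := length_localization_hypersurface hψ hn hker hf hf' 0
      simpa [Finset.sum_range_succ, add_comm] using this
  rw [← ENat.WithBot.add_one_cancel, hdim]
  split_ifs at hfin with h
  · simp only [h, iff_true]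
    exact_mod_cast hfin
  · simp only [h, iff_false]
    intro h'
    have : Module.finrank (ResidueField (Localization.AtPrime n))
      (CotangentSpace (Localization.AtPrime n)) + 1 = Fintype.card τ := by exact_mod_cast h'
    omega

end Hypersurface

/-! ### Local rings of affine hypersurfaces in coordinate subspaces -/

/-- Here `T` indexes the free coordinates of an affine subspace through `v`, and `f` is the equation
of `Y` in it after moving `v` to the origin. Since `f` is squarefree, the ideal it generates is
radical, and the Nullstellensatz makes it the full kernel of the map onto the coordinate ring. -/
theorem affineLocalRing_hypersurface {σ : Type*} {Y : Set (σ → ℂ)} {v : Y}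
    {T : Set σ} [Fintype T] {f : MvPolynomial T ℂ}
    (hY : ∀ y : σ → ℂ, y ∈ Y ↔ (∀ s ∉ T, y s = v.1 s) ∧ eval (fun s : T => y s - v.1 s) f = 0)
    (hsq : Squarefree f) {r : ℕ} (hr : r = 1 ∨ r = 2)
    (hf : f ∈ idealOfVars T ℂ ^ r) (hf' : f ∉ idealOfVars T ℂ ^ (r + 1)) :
    HasHilbertSamuelMultiplicity (AffineLocalRing Y v) r ∧
      (IsRegularLocalRing (AffineLocalRing Y v) ↔ r = 1) := by
  classical
  let θ : MvPolynomial T ℂ →ₐ[ℂ] MvPolynomial σ ℂ :=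
    aeval fun s : T => MvPolynomial.X (s : σ) - C (v.1 s)
  let π : MvPolynomial σ ℂ →ₐ[ℂ] CoordRing Y := Ideal.Quotient.mkₐ ℂ _
  let ψ : MvPolynomial T ℂ →ₐ[ℂ] CoordRing Y := π.comp θ
  have hθ : ∀ (y : σ → ℂ) (g : MvPolynomial T ℂ),
      aeval y (θ g) = eval (fun s : T => y s - v.1 s) g := by
    intro y g
    have : (aeval y).comp θ = aeval (fun s : T => y s - v.1 s) := by
      ext s
      simp [θ]
    rw [← AlgHom.comp_apply, this]
    rfl
  have hψ : Function.Surjective ψ := by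
    let φ : MvPolynomial σ ℂ →ₐ[ℂ] MvPolynomial T ℂ :=
      aeval fun s => (if h : s ∈ T then MvPolynomial.X ⟨s, h⟩ else 0) + C (v.1 s)
    have hφ : ψ.comp φ = π := by
      ext s
      by_cases h : s ∈ T
      · simp [ψ, φ, θ, h, ← algebraMap_eq]
      · have h1 : π (MvPolynomial.X s - C (v.1 s)) = 0 := by
          refine Ideal.Quotient.eq_zero_iff_mem.2 fun y hy => ?_
          simp [((hY y).1 hy).1 s h]
        rw [map_sub, sub_eq_zero] at h1
        simp only [AlgHom.comp_apply, φ, aeval_X, h, dif_neg, not_false_iff, zero_add]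
        rw [h1, ← algebraMap_eq, AlgHom.commutes, ← algebraMap_eq, AlgHom.commutes]
    intro a
    obtain ⟨p, rfl⟩ := Ideal.Quotient.mk_surjective a
    exact ⟨φ p, DFunLike.congr_fun hφ p⟩
  have hker : RingHom.ker ψ = Ideal.span {f} := by
    have h1 : RingHom.ker ψ = vanishingIdeal ℂ (zeroLocus ℂ (Ideal.span {f})) := by
      ext g
      rw [RingHom.mem_ker, mem_vanishingIdeal_iff]
      constructor
      · intro h w hw
        let y : σ → ℂ := fun s => (if h : s ∈ T then w ⟨s, h⟩ else 0) + v.1 s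
        have hyw : (fun s : T => y s - v.1 s) = w := by
          ext s; simp [y]
        have hy : y ∈ Y := by
          refine (hY y).2 ⟨fun s hs => by simp [y, hs], ?_⟩
          rw [hyw]
          exact hw f (Ideal.mem_span_singleton_self f)
        have := (Ideal.Quotient.eq_zero_iff_mem.1 h : θ g ∈ vanishingIdeal ℂ Y) y hy
        rwa [hθ, hyw] at this
      · intro h
        refine Ideal.Quotient.eq_zero_iff_mem.2 fun y hy => ?_
        refine (hθ y g).trans ?_
        refine h _ fun p hp => ?_
        obtain ⟨q, rfl⟩ := Ideal.mem_span_singleton'.1 hp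
        rw [map_mul]
        exact mul_eq_zero_of_right _ ((hY y).1 hy).2
    rw [h1, vanishingIdeal_zeroLocus_eq_radical]
    exact (isRadical_iff_span_singleton.1 hsq.isRadical).radical
  have hn : (pointIdeal Y v).comap ψ = idealOfVars T ℂ := by
    ext g
    have h1 : evalAt Y v (ψ g) = aeval v.1 (θ g) := rfl
    have h2 : (fun s : T => v.1 s - v.1 s) = (0 : T → ℂ) := by ext; simp
    rw [Ideal.mem_comap, pointIdeal, RingHom.mem_ker, h1, hθ, h2, ← pow_one (idealOfVars T ℂ),
      mem_pow_idealOfVars_iff']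
    simp [Finsupp.degree_eq_zero_iff, ← constantCoeff_eq, eval_zero]
  exact ⟨hasHilbertSamuelMultiplicity_hypersurface hψ hn hker (by omega) hf hf',
    isRegularLocalRing_hypersurface_iff hψ hn hker hr hf hf'⟩

/-! ### Auxiliary facts on polynomials -/

theorem pderiv_mem_pow_idealOfVars {τ : Type*} {g : MvPolynomial τ ℂ} {k : ℕ}
    (hg : g ∈ idealOfVars τ ℂ ^ (k + 1)) (s : τ) : pderiv s g ∈ idealOfVars τ ℂ ^ k := by
  rw [mem_pow_idealOfVars_iff'] at *
  intro d hd
  rw [coeff_pderiv, hg _ (by simpa using hd), zero_mul]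

/-- By degrees, a nonconstant common divisor would be proportional to `X a + C c`. -/
theorem isUnit_of_dvd_X_add_C {τ : Type*} {g : MvPolynomial τ ℂ} {a b : τ} {c c' : ℂ}
    (hab : a ≠ b) (ha : g ∣ MvPolynomial.X a + C c) (hb : g ∣ MvPolynomial.X b + C c') :
    IsUnit g := by
  classical
  have hdeg : (MvPolynomial.X a + C c : MvPolynomial τ ℂ).totalDegree = 1 := by
    rw [totalDegree_add_eq_left_of_totalDegree_lt] <;> simp
  have hne : (MvPolynomial.X a + C c : MvPolynomial τ ℂ) ≠ 0 := by
    intro h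
    simp [h] at hdeg
  obtain ⟨h, hh⟩ := ha
  have hg0 : g ≠ 0 := by rintro rfl; simp [hne] at hh
  have hh0 : h ≠ 0 := by rintro rfl; simp [hne] at hh
  have hsum : g.totalDegree + h.totalDegree = 1 := by
    rw [← totalDegree_mul_of_isDomain hg0 hh0, ← hh, hdeg]
  rcases Nat.eq_zero_or_pos g.totalDegree with hg | hg
  · rw [totalDegree_eq_zero_iff_eq_C] at hg
    rw [hg] at hg0 ⊢
    exact (isUnit_iff_ne_zero.2 fun h => hg0 (by rw [h, C_0])).map C
  · have hhd : h.totalDegree = 0 := by omega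
    rw [totalDegree_eq_zero_iff_eq_C] at hhd
    exfalso
    have hu : h.coeff 0 ≠ 0 := fun h' => hh0 (by rw [hhd, h', C_0])
    obtain ⟨q, hq⟩ := hb
    -- At this point the first linear form, hence `g`, vanishes, while the second takes the value 1.
    let w : τ → ℂ := Function.update (fun _ => -c) b (1 - c')
    have h1 := congrArg (eval w) hh
    have h2 := congrArg (eval w) hq
    rw [hhd] at h1
    simp [w, hab, hu] at h1
    simp [w, h1] at h2

theorem dvd_pderiv_of_mul_self_dvd {τ : Type*} {f g : MvPolynomial τ ℂ} (h : g * g ∣ f) (s : τ) :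
    g ∣ pderiv s f := by
  obtain ⟨q, rfl⟩ := h
  simp only [pderiv_mul]
  exact ⟨pderiv s g * q + pderiv s g * q + g * pderiv s q, by ring⟩

/-! ### The quadratic form -/

theorem Q_eq_sum (n : ℕ) (x : Fin (2 * n + 1) → ℂ) : Q n x = ∑ s, x s * x s.rev := by
  let g : ℕ → ℂ := fun i =>
    if h : i < 2 * n + 1 then x ⟨i, h⟩ * x ⟨2 * n - i, by omega⟩ else 0
  have hg : ∑ s, x s * x s.rev = ∑ i ∈ Finset.range (2 * n + 1), g i := by
    rw [Finset.sum_range]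
    refine Finset.sum_congr rfl fun s _ => ?_
    simp only [g, s.2, dif_pos]
    congr 2
    ext
    simp [Fin.val_rev]
  have hrefl : ∑ j ∈ Finset.range n, g (n + 1 + j) = ∑ i ∈ Finset.range n, g i := by
    rw [← Finset.sum_range_reflect]
    refine Finset.sum_congr rfl fun i hi => ?_
    rw [Finset.mem_range] at hi
    have h1 : n + 1 + (n - 1 - i) = 2 * n - i := by omega
    have h2 : 2 * n - i < 2 * n + 1 := by omega
    have h3 : i < 2 * n + 1 := by omega
    have h4 : 2 * n - (2 * n - i) = i := by omega
    simp only [g, h1, h2, h3, dif_pos, h4]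
    ring
  have hmid : g n = x ⟨n, by omega⟩ ^ 2 := by
    have h1 : n < 2 * n + 1 := by omega
    have h2 : 2 * n - n = n := by omega
    simp only [g, h1, dif_pos, h2]
    ring
  have hlow : ∑ i : Fin n, x ⟨i, by omega⟩ * x ⟨2 * n - i, by omega⟩ =
      ∑ i ∈ Finset.range n, g i := by
    rw [Finset.sum_range]
    refine Finset.sum_congr rfl fun i _ => ?_
    have h1 : (i : ℕ) < 2 * n + 1 := by omega
    simp only [g, h1, dif_pos]
  rw [hg, show 2 * n + 1 = n + 1 + n by ring, Finset.sum_range_add, Finset.sum_range_succ, hrefl,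
    Q, hmid, hlow]
  ring

theorem Q_smul (n : ℕ) (c : ℂ) (x : Fin (2 * n + 1) → ℂ) : Q n (c • x) = c ^ 2 * Q n x := by
  simp only [Q_eq_sum, Pi.smul_apply, smul_eq_mul, Finset.mul_sum]
  exact Finset.sum_congr rfl fun s _ => by ring

/-- The middle index. -/
def mid (n : ℕ) : Fin (2 * n + 1) := ⟨n, by omega⟩

theorem rev_eq_self_iff {n : ℕ} {s : Fin (2 * n + 1)} : s.rev = s ↔ s = mid n := by
  simp only [Fin.ext_iff, Fin.val_rev, mid]
  omega

@[simp] theorem rev_mid (n : ℕ) : (mid n).rev = mid n := rev_eq_self_iff.2 rfl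

/-- The intersection of the quadric with a coordinate subspace. -/
def coordSection (n : ℕ) (I : Set (Fin (2 * n + 1))) : Set (PSpace n) :=
  {p | p ∈ quadric n ∧ ∀ s ∉ I, p.rep s = 0}

theorem mk_mem_coordSection {n : ℕ} {I : Set (Fin (2 * n + 1))} {v : Fin (2 * n + 1) → ℂ}
    (hv : v ≠ 0) : Projectivization.mk ℂ v hv ∈ coordSection n I ↔
      Q n v = 0 ∧ ∀ s ∉ I, v s = 0 := by
  obtain ⟨a, ha⟩ := Projectivization.exists_smul_eq_mk_rep ℂ v hv
  have ha' : (a : ℂ) • v = (Projectivization.mk ℂ v hv).rep := ha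
  simp only [coordSection, quadric, Set.mem_ofPred_eq, ← ha', Q_smul, Pi.smul_apply, smul_eq_mul,
    mul_eq_zero, a.ne_zero, false_or, pow_eq_zero_iff two_ne_zero]

theorem mem_affineTrace_coordSection {n : ℕ} {I : Set (Fin (2 * n + 1))} {k : Fin (2 * n + 1)}
    {v : Fin (2 * n + 1) → ℂ} :
    v ∈ affineTrace (coordSection n I) k ↔ v k = 1 ∧ Q n v = 0 ∧ ∀ s ∉ I, v s = 0 := by
  constructor
  · rintro ⟨h1, h, h2⟩
    exact ⟨h1, (mk_mem_coordSection h).1 h2⟩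
  · rintro ⟨h1, h2⟩
    have h : v ≠ 0 := by rintro rfl; simp at h1
    exact ⟨h1, h, (mk_mem_coordSection h).2 h2⟩

/-! ### Quadratic sections in an affine chart -/

section Chart

variable {n : ℕ} {T : Set (Fin (2 * n + 1))} {v : Fin (2 * n + 1) → ℂ}

open Classical in
/-- The coordinate functions on the affine space of points that agree with `v` outside `T`. -/
def shiftedCoord (T : Set (Fin (2 * n + 1))) (v : Fin (2 * n + 1) → ℂ) (s : Fin (2 * n + 1)) :
    MvPolynomial T ℂ :=
  (if h : s ∈ T then MvPolynomial.X ⟨s, h⟩ else 0) + C (v s)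

/-- The quadratic form on the affine space of points that agree with `v` outside `T`. -/
def shiftedQuadric (T : Set (Fin (2 * n + 1))) (v : Fin (2 * n + 1) → ℂ) : MvPolynomial T ℂ :=
  ∑ s, shiftedCoord T v s * shiftedCoord T v s.rev

theorem shiftedCoord_of_mem {s : Fin (2 * n + 1)} (h : s ∈ T) :
    shiftedCoord T v s = MvPolynomial.X ⟨s, h⟩ + C (v s) := by
  simp [shiftedCoord, h]

theorem shiftedCoord_of_notMem {s : Fin (2 * n + 1)} (h : s ∉ T) :
    shiftedCoord T v s = C (v s) := by
  simp [shiftedCoord, h]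

theorem eval_shiftedCoord (s : Fin (2 * n + 1)) (w : T → ℂ) :
    eval w (shiftedCoord T v s) = (open Classical in if h : s ∈ T then w ⟨s, h⟩ else 0) + v s := by
  by_cases h : s ∈ T
  · simp [shiftedCoord_of_mem h, h]
  · simp [shiftedCoord_of_notMem h, h]

theorem eval_shiftedQuadric {y : Fin (2 * n + 1) → ℂ} (hy : ∀ s ∉ T, y s = v s) :
    eval (fun s : T => y s - v s) (shiftedQuadric T v) = Q n y := by
  have h : ∀ s, eval (fun s : T => y s - v s) (shiftedCoord T v s) = y s := by
    intro s
    rw [eval_shiftedCoord]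
    by_cases h : s ∈ T
    · simp [h]
    · simp [h, hy s h]
  rw [shiftedQuadric, map_sum, Q_eq_sum]
  exact Finset.sum_congr rfl fun s _ => by rw [map_mul, h, h]

theorem pderiv_shiftedCoord (s : T) (l : Fin (2 * n + 1)) :
    pderiv s (shiftedCoord T v l) = if l = s then 1 else 0 := by
  classical
  by_cases h : l ∈ T
  · rw [shiftedCoord_of_mem h]
    simp [pderiv_X, Pi.single_apply, Subtype.ext_iff, eq_comm]
  · have : l ≠ s := by rintro rfl; exact h s.2
    rw [shiftedCoord_of_notMem h]
    simp [this]

theorem pderiv_shiftedQuadric (s : T) :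
    pderiv s (shiftedQuadric T v) = 2 * shiftedCoord T v (s : Fin (2 * n + 1)).rev := by
  have h : ∀ l : Fin (2 * n + 1), l.rev = s ↔ l = (s : Fin (2 * n + 1)).rev := fun l =>
    ⟨fun h => by rw [← h, Fin.rev_rev], fun h => by rw [h, Fin.rev_rev]⟩
  simp only [shiftedQuadric, map_sum, pderiv_mul, pderiv_shiftedCoord, h, Finset.sum_add_distrib]
  simp [two_mul]

/-- If `g * g` divides the equation, `g` divides all its partial derivatives, which are twice the
mirrored coordinates. Among the three middle coordinates two are always reached: they are distinct
shifted variables, or one of them is the chart coordinate, equal to 1. Either way `g` is a unit. -/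
theorem squarefree_shiftedQuadric {I : Set (Fin (2 * n + 1))} {k : Fin (2 * n + 1)}
    (hI : ∀ s : Fin (2 * n + 1), n ≤ (s : ℕ) + 1 → (s : ℕ) ≤ n + 1 → s ∈ I) (hn : 1 ≤ n)
    (hk : v k = 1) : Squarefree (shiftedQuadric (I \ {k}) v) := by
  intro g hg
  have key : ∀ l : Fin (2 * n + 1), l.rev ∈ I → l.rev ≠ k → g ∣ shiftedCoord (I \ {k}) v l := by
    intro l hl hlk
    have h := dvd_pderiv_of_mul_self_dvd hg ⟨l.rev, hl, hlk⟩
    rw [pderiv_shiftedQuadric, Fin.rev_rev] at h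
    have h2 : IsUnit (2 : MvPolynomial (I \ {k} : Set (Fin (2 * n + 1))) ℂ) := by
      have := (isUnit_iff_ne_zero.2 (two_ne_zero (α := ℂ))).map
        (C : ℂ →+* MvPolynomial (I \ {k} : Set (Fin (2 * n + 1))) ℂ)
      rwa [map_ofNat] at this
    exact (h2.dvd_mul_left).1 h
  have pair : ∀ a b : Fin (2 * n + 1), a ≠ b → a ∈ I → b ∈ I → a.rev ∈ I → b.rev ∈ I →
      a.rev ≠ k → b.rev ≠ k → IsUnit g := by
    intro a b hab ha hb ha' hb' hak hbk
    have h1 := key a ha' hak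
    have h2 := key b hb' hbk
    by_cases hka : a = k
    · rw [shiftedCoord_of_notMem (by simp [hka]), hka, hk] at h1
      exact isUnit_of_dvd_one (by simpa using h1)
    by_cases hkb : b = k
    · rw [shiftedCoord_of_notMem (by simp [hkb]), hkb, hk] at h2
      exact isUnit_of_dvd_one (by simpa using h2)
    rw [shiftedCoord_of_mem (show a ∈ I \ {k} from ⟨ha, hka⟩)] at h1
    rw [shiftedCoord_of_mem (show b ∈ I \ {k} from ⟨hb, hkb⟩)] at h2
    exact isUnit_of_dvd_X_add_C (fun h => hab (congrArg Subtype.val h)) h1 h2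
  let a : Fin (2 * n + 1) := ⟨n - 1, by omega⟩
  let b : Fin (2 * n + 1) := ⟨n, by omega⟩
  let c : Fin (2 * n + 1) := ⟨n + 1, by omega⟩
  have ha : a ∈ I := hI a (by simp [a]; omega) (by simp [a]; omega)
  have hb : b ∈ I := hI b (by simp [b]) (by simp [b])
  have hc : c ∈ I := hI c (by simp [c]; omega) (by simp [c])
  have ra : a.rev = c := by ext; simp [a, c, Fin.val_rev]; omega
  have rb : b.rev = b := by ext; simp [b, Fin.val_rev]; omega
  have rc : c.rev = a := by rw [← ra, Fin.rev_rev]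
  have hab : a ≠ b := by simp [a, b, Fin.ext_iff]; omega
  have hbc : b ≠ c := by simp [b, c, Fin.ext_iff]
  have hac : a ≠ c := by simp [a, c, Fin.ext_iff]
  by_cases hkb : k = b
  · exact pair a c hac ha hc (ra ▸ hc) (rc ▸ ha) (by rw [ra, hkb]; exact hbc.symm)
      (by rw [rc, hkb]; exact hab)
  · by_cases hkc : k = c
    · exact pair b c hbc hb hc (rb.symm ▸ hb) (rc ▸ ha) (by rw [rb]; exact fun h => hkb h.symm)
        (by rw [rc, hkc]; exact hac)
    · exact pair a b hab ha hb (ra ▸ hc) (rb.symm ▸ hb) (by rw [ra]; exact fun h => hkc h.symm)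
        (by rw [rb]; exact fun h => hkb h.symm)

theorem shiftedQuadric_mem (h : Q n v = 0) : shiftedQuadric T v ∈ idealOfVars T ℂ := by
  have h1 := eval_shiftedQuadric (T := T) (v := v) (y := v) fun _ _ => rfl
  have h2 : (fun s : T => v s - v s) = (0 : T → ℂ) := by ext; simp
  rw [h, h2] at h1
  rw [← pow_one (idealOfVars T ℂ), mem_pow_idealOfVars_iff']
  simpa [Finsupp.degree_eq_zero_iff, ← constantCoeff_eq, eval_zero] using h1

theorem C_mem_idealOfVars_iff {τ : Type*} {c : ℂ} :
    (C c : MvPolynomial τ ℂ) ∈ idealOfVars τ ℂ ↔ c = 0 := by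
  have := C_mem_pow_idealOfVars_iff (σ := τ) 1 c
  rw [pow_one] at this
  rw [this]; simp

theorem shiftedCoord_mem_iff {s : Fin (2 * n + 1)} :
    shiftedCoord T v s ∈ idealOfVars T ℂ ↔ v s = 0 := by
  classical
  have h : (if h : s ∈ T then MvPolynomial.X ⟨s, h⟩ else 0 : MvPolynomial T ℂ) ∈
      idealOfVars T ℂ := by
    split_ifs with h
    · exact Ideal.subset_span ⟨_, rfl⟩
    · exact zero_mem _
  rw [← C_mem_idealOfVars_iff (τ := T)]
  unfold shiftedCoord
  convert (Ideal.add_mem_iff_right _ h)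

/-- The derivative in direction `s` has constant term twice this coordinate, so there is a linear
term. -/
theorem shiftedQuadric_notMem_sq {s : T} (hs : v (s : Fin (2 * n + 1)).rev ≠ 0) :
    shiftedQuadric T v ∉ idealOfVars T ℂ ^ 2 := by
  intro h
  have h1 := pderiv_mem_pow_idealOfVars h s
  have h2 : (C (1 / 2) : MvPolynomial T ℂ) * 2 = 1 := by
    have : (2 : MvPolynomial T ℂ) = C 2 := (map_ofNat C 2).symm
    rw [this, ← C_mul]; norm_num
  have h3 := Ideal.mul_mem_left _ (C (1 / 2)) h1
  rw [pow_one, pderiv_shiftedQuadric, ← mul_assoc, h2, one_mul, shiftedCoord_mem_iff] at h3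
  exact hs h3

theorem shiftedQuadric_mem_sq (h : ∀ s, shiftedCoord T v s = 0 ∨ shiftedCoord T v s.rev = 0 ∨
    (v s = 0 ∧ v s.rev = 0)) : shiftedQuadric T v ∈ idealOfVars T ℂ ^ 2 := by
  refine Ideal.sum_mem _ fun s _ => ?_
  rcases h s with h | h | ⟨h, h'⟩
  · rw [h, zero_mul]; exact zero_mem _
  · rw [h, mul_zero]; exact zero_mem _
  · rw [pow_two]
    exact Ideal.mul_mem_mul (shiftedCoord_mem_iff.2 h) (shiftedCoord_mem_iff.2 h')

/-- The middle variable occurs squared, so its second derivative is the constant 2. -/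
theorem shiftedQuadric_notMem_cube (h : mid n ∈ T) :
    shiftedQuadric T v ∉ idealOfVars T ℂ ^ 3 := by
  intro h0
  have h1 := pderiv_mem_pow_idealOfVars (pderiv_mem_pow_idealOfVars h0 ⟨mid n, h⟩) ⟨mid n, h⟩
  have h2 : (2 : MvPolynomial T ℂ) = C 2 := (map_ofNat C 2).symm
  rw [pderiv_shiftedQuadric, rev_mid, h2, pderiv_C_mul, pderiv_shiftedCoord, if_pos rfl, mul_one,
    pow_one, C_mem_idealOfVars_iff] at h1
  exact two_ne_zero h1

end Chart

/-! ### Local rings of coordinate sections of the quadric -/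

section LocalRings

variable {n : ℕ} {I : Set (Fin (2 * n + 1))} {k : Fin (2 * n + 1)}

theorem mem_affineTrace_iff_eval_shiftedQuadric (v : affineTrace (coordSection n I) k)
    (y : Fin (2 * n + 1) → ℂ) :
    y ∈ affineTrace (coordSection n I) k ↔ (∀ s ∉ I \ {k}, y s = v.1 s) ∧
      eval (fun s : (I \ {k} : Set (Fin (2 * n + 1))) => y s - v.1 s)
        (shiftedQuadric (I \ {k}) v.1) = 0 := by
  obtain ⟨hvk, -, hvI⟩ := mem_affineTrace_coordSection.1 v.2
  rw [mem_affineTrace_coordSection]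
  constructor
  · rintro ⟨h1, h2, h3⟩
    have h : ∀ s ∉ I \ {k}, y s = v.1 s := by
      intro s hs
      by_cases hsI : s ∈ I
      · have : s = k := by
          by_contra hsk
          exact hs ⟨hsI, hsk⟩
        rw [this, h1, hvk]
      · rw [h3 s hsI, hvI s hsI]
    exact ⟨h, by rw [eval_shiftedQuadric h, h2]⟩
  · rintro ⟨h, h2⟩
    rw [eval_shiftedQuadric h] at h2
    exact ⟨by rw [h k (by simp), hvk], h2, fun s hs => by rw [h s fun h' => hs h'.1, hvI s hs]⟩

theorem localRing_quadratic_of_vanish (hn : 1 ≤ n)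
    (hI : ∀ s : Fin (2 * n + 1), n ≤ (s : ℕ) + 1 → (s : ℕ) ≤ n + 1 → s ∈ I)
    (v : affineTrace (coordSection n I) k) (hv : ∀ s ∈ I, s.rev ∈ I → v.1 s = 0) :
    HasHilbertSamuelMultiplicity (AffineLocalRing (affineTrace (coordSection n I) k) v) 2 ∧
      ¬ IsRegularLocalRing (AffineLocalRing (affineTrace (coordSection n I) k) v) := by
  classical
  obtain ⟨hvk, -, hvI⟩ := mem_affineTrace_coordSection.1 v.2
  have hmI : mid n ∈ I := hI _ (by simp [mid]) (by simp [mid])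
  have hmk : mid n ≠ k := by
    rintro rfl
    rw [hv _ hmI (by simpa using hmI)] at hvk
    exact zero_ne_one hvk
  have hcoord : ∀ s ∉ I, shiftedCoord (I \ {k}) v.1 s = 0 := by
    intro s hs
    rw [shiftedCoord_of_notMem fun h => hs h.1, hvI s hs, C_0]
  have := affineLocalRing_hypersurface (mem_affineTrace_iff_eval_shiftedQuadric v)
    (squarefree_shiftedQuadric hI hn hvk) (r := 2) (by simp)
    (shiftedQuadric_mem_sq fun s => by
      by_cases hs : s ∈ I
      · by_cases hs' : s.rev ∈ I
        · exact Or.inr (Or.inr ⟨hv s hs hs', hv _ hs' (by rwa [Fin.rev_rev])⟩)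
        · exact Or.inr (Or.inl (hcoord _ hs'))
      · exact Or.inl (hcoord s hs))
    (shiftedQuadric_notMem_cube ⟨hmI, hmk⟩)
  exact ⟨this.1, fun h => absurd (this.2.1 h) (by norm_num)⟩

theorem localRing_quadratic_of_not_vanish (hn : 1 ≤ n)
    (hI : ∀ s : Fin (2 * n + 1), n ≤ (s : ℕ) + 1 → (s : ℕ) ≤ n + 1 → s ∈ I)
    (v : affineTrace (coordSection n I) k) (hv : ¬ ∀ s ∈ I, s.rev ∈ I → v.1 s = 0) :
    HasHilbertSamuelMultiplicity (AffineLocalRing (affineTrace (coordSection n I) k) v) 1 ∧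
      IsRegularLocalRing (AffineLocalRing (affineTrace (coordSection n I) k) v) := by
  classical
  obtain ⟨hvk, hvQ, hvI⟩ := mem_affineTrace_coordSection.1 v.2
  have hk1 : v.1 k ≠ 0 := by rw [hvk]; exact one_ne_zero
  -- The variable `k` is frozen in the chart, so a nonzero partial derivative must be found in
  -- another direction. If the obvious one is `k`, then `k.rev` serves because `v k = 1`. If
  -- moreover `k` is the middle index, the absence of any other direction would give `Q n v = 1`.
  have hex : ∃ t ∈ I \ {k}, v.1 t.rev ≠ 0 := by
    push Not at hv
    obtain ⟨s, hs, hs', hvs⟩ := hv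
    by_cases h1 : s.rev = k
    · by_cases h2 : k.rev = k
      · by_contra hcon
        push Not at hcon
        rw [Q_eq_sum, Finset.sum_eq_single k] at hvQ
        · rw [h2, hvk] at hvQ
          norm_num at hvQ
        · intro t _ htk
          by_cases htI : t ∈ I
          · rw [hcon t ⟨htI, htk⟩, mul_zero]
          · rw [hvI t htI, zero_mul]
        · simp
      · refine ⟨k.rev, ⟨?_, h2⟩, by rwa [Fin.rev_rev]⟩
        rwa [← h1, Fin.rev_rev]
    · exact ⟨s.rev, ⟨hs', h1⟩, by rwa [Fin.rev_rev]⟩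
  obtain ⟨t, ht, hvt⟩ := hex
  have := affineLocalRing_hypersurface (mem_affineTrace_iff_eval_shiftedQuadric v)
    (squarefree_shiftedQuadric hI hn hvk) (r := 1) (by simp)
    (by rw [pow_one]; exact shiftedQuadric_mem hvQ)
    (shiftedQuadric_notMem_sq (s := ⟨t, ht⟩) hvt)
  exact ⟨this.1, this.2.2 rfl⟩

theorem localRing_linear (hI : ∀ s ∈ I, s.rev ∉ I) (v : affineTrace (coordSection n I) k) :
    HasHilbertSamuelMultiplicity (AffineLocalRing (affineTrace (coordSection n I) k) v) 1 ∧
      IsRegularLocalRing (AffineLocalRing (affineTrace (coordSection n I) k) v) := by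
  classical
  obtain ⟨hvk, hvQ, hvI⟩ := mem_affineTrace_coordSection.1 v.2
  have hmI : mid n ∉ I := fun h => hI _ h (by simpa using h)
  have hmk : mid n ≠ k := by
    rintro rfl
    rw [hvI _ hmI] at hvk
    exact zero_ne_one hvk
  -- The trace is an affine space. Adding the middle coordinate as a dummy variable presents it as
  -- the hyperplane where that variable vanishes, so the hypersurface lemma applies.
  let T : Set (Fin (2 * n + 1)) := insert (mid n) I \ {k}
  have hmT : mid n ∈ T := ⟨Set.mem_insert _ _, hmk⟩
  let f : MvPolynomial T ℂ := MvPolynomial.X ⟨mid n, hmT⟩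
  have hf : f ∈ idealOfVars T ℂ ^ 1 := by
    rw [pow_one]
    exact Ideal.subset_span ⟨_, rfl⟩
  have hf' : f ∉ idealOfVars T ℂ ^ (1 + 1) := by
    intro h
    have := pderiv_mem_pow_idealOfVars h ⟨mid n, hmT⟩
    rw [pow_one, pderiv_X_self, ← C_1, C_mem_idealOfVars_iff] at this
    exact one_ne_zero this
  have := affineLocalRing_hypersurface (v := v) (T := T) (f := f) (fun y => by
      rw [mem_affineTrace_coordSection, eval_X]
      simp only [hvI _ hmI, sub_zero]
      constructor
      · rintro ⟨h1, h2, h3⟩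
        refine ⟨fun s hs => ?_, h3 _ hmI⟩
        by_cases hsk : s = k
        · rw [hsk, h1, hvk]
        · have : s ∉ I := fun h => hs ⟨Set.mem_insert_of_mem _ h, hsk⟩
          rw [h3 s this, hvI s this]
      · rintro ⟨h1, h2⟩
        have h3 : ∀ s ∉ I, y s = 0 := by
          intro s hs
          by_cases hsm : s = mid n
          · rw [hsm, h2]
          · rw [h1 s fun h => h.1.elim hsm hs, hvI s hs]
        refine ⟨by rw [h1 k fun h => h.2 rfl, hvk], ?_, h3⟩
        rw [Q_eq_sum]
        refine Finset.sum_eq_zero fun s _ => ?_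
        by_cases hs : s ∈ I
        · rw [h3 _ (hI s hs), mul_zero]
        · rw [h3 s hs, zero_mul])
    X_prime.irreducible.squarefree (r := 1) (by simp) hf hf'
  exact ⟨this.1, this.2.2 rfl⟩

end LocalRings

/-! ### Multiplicities and singular loci of sections of the quadric -/

/-- Two polynomials agreeing at all large integers are equal. -/
theorem HasHilbertSamuelMultiplicity.unique {R : Type*} [CommRing R] [IsLocalRing R] {a b : ℕ}
    (ha : HasHilbertSamuelMultiplicity R a) (hb : HasHilbertSamuelMultiplicity R b) : a = b := by
  obtain ⟨P, hP, ha⟩ := ha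
  obtain ⟨P', hP', hb⟩ := hb
  have h : P = P' := by
    apply Polynomial.eq_of_infinite_eval_eq
    obtain ⟨N, hN⟩ := Filter.eventually_atTop.1 (hP.and hP')
    apply ((Set.Ici_infinite N).image (Nat.cast_injective (R := ℚ)).injOn).mono
    rintro _ ⟨k, hk, rfl⟩
    obtain ⟨⟨l, hl, h⟩, ⟨l', hl', h'⟩⟩ := hN k hk
    rw [hl] at hl'
    have : l = l' := by exact_mod_cast hl'
    simp only [Set.mem_ofPred_eq, h, h', this]
  subst h
  rw [ha] at hb
  exact_mod_cast hb

theorem exists_rep_ne_zero {σ : Type*} (p : ℙ ℂ (σ → ℂ)) : ∃ k, p.rep k ≠ 0 := by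
  by_contra! h
  exact p.rep_nonzero (funext h)

theorem HasMultiplicity.unique {σ : Type*} {Y : Set (ℙ ℂ (σ → ℂ))} {p : ℙ ℂ (σ → ℂ)} {a b : ℕ}
    (ha : HasMultiplicity Y p a) (hb : HasMultiplicity Y p b) : a = b := by
  obtain ⟨k, hk⟩ := exists_rep_ne_zero p
  obtain ⟨hp, ha⟩ := ha
  obtain ⟨_, hb⟩ := hb
  exact (ha k hk).unique (hb k hk)

section Global

variable {n : ℕ} {I : Set (Fin (2 * n + 1))}

theorem hasMultiplicity_coordSection_linear (hI : ∀ s ∈ I, s.rev ∉ I) {p : PSpace n}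
    (hp : p ∈ coordSection n I) :
    HasMultiplicity (coordSection n I) p 1 ∧ IsSmoothPoint (coordSection n I) p :=
  ⟨⟨hp, fun _ _ => (localRing_linear hI _).1⟩, ⟨hp, fun _ _ => (localRing_linear hI _).2⟩⟩

theorem sing_coordSection_linear (hI : ∀ s ∈ I, s.rev ∉ I) : Sing (coordSection n I) = ∅ :=
  Set.eq_empty_of_forall_notMem fun _ hp => hp.2 (hasMultiplicity_coordSection_linear hI hp.1).2

theorem hasMultiplicity_coordSection_of_vanish (hn : 1 ≤ n)
    (hI : ∀ s : Fin (2 * n + 1), n ≤ (s : ℕ) + 1 → (s : ℕ) ≤ n + 1 → s ∈ I) {p : PSpace n}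
    (hp : p ∈ coordSection n I) (hv : ∀ s ∈ I, s.rev ∈ I → p.rep s = 0) :
    HasMultiplicity (coordSection n I) p 2 ∧ ¬ IsSmoothPoint (coordSection n I) p := by
  have key := fun k hk => localRing_quadratic_of_vanish hn hI
    (tracePoint (coordSection n I) p hp k hk) (fun s hs hs' => by simp [tracePoint, hv s hs hs'])
  refine ⟨⟨hp, fun k hk => (key k hk).1⟩, ?_⟩
  rintro ⟨_, h⟩
  obtain ⟨k, hk⟩ := exists_rep_ne_zero p
  exact (key k hk).2 (h k hk)

theorem hasMultiplicity_coordSection_of_not_vanish (hn : 1 ≤ n)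
    (hI : ∀ s : Fin (2 * n + 1), n ≤ (s : ℕ) + 1 → (s : ℕ) ≤ n + 1 → s ∈ I) {p : PSpace n}
    (hp : p ∈ coordSection n I) (hv : ¬ ∀ s ∈ I, s.rev ∈ I → p.rep s = 0) :
    HasMultiplicity (coordSection n I) p 1 ∧ IsSmoothPoint (coordSection n I) p := by
  have key := fun k hk => localRing_quadratic_of_not_vanish hn hI
    (tracePoint (coordSection n I) p hp k hk) (fun h => hv fun s hs hs' => by
      simpa [tracePoint, hk] using h s hs hs')
  exact ⟨⟨hp, fun k hk => (key k hk).1⟩, ⟨hp, fun k hk => (key k hk).2⟩⟩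

theorem hasMultiplicity_two_iff (hn : 1 ≤ n)
    (hI : ∀ s : Fin (2 * n + 1), n ≤ (s : ℕ) + 1 → (s : ℕ) ≤ n + 1 → s ∈ I) {p : PSpace n}
    (hp : p ∈ coordSection n I) :
    HasMultiplicity (coordSection n I) p 2 ↔ ∀ s ∈ I, s.rev ∈ I → p.rep s = 0 := by
  refine ⟨fun h => ?_, fun h => (hasMultiplicity_coordSection_of_vanish hn hI hp h).1⟩
  by_contra hv
  exact absurd (h.unique (hasMultiplicity_coordSection_of_not_vanish hn hI hp hv).1) (by norm_num)

theorem hasMultiplicity_one_iff (hn : 1 ≤ n)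
    (hI : ∀ s : Fin (2 * n + 1), n ≤ (s : ℕ) + 1 → (s : ℕ) ≤ n + 1 → s ∈ I) {p : PSpace n}
    (hp : p ∈ coordSection n I) :
    HasMultiplicity (coordSection n I) p 1 ↔ ¬ ∀ s ∈ I, s.rev ∈ I → p.rep s = 0 := by
  refine ⟨fun h hv => ?_, fun h => (hasMultiplicity_coordSection_of_not_vanish hn hI hp h).1⟩
  exact absurd (h.unique (hasMultiplicity_coordSection_of_vanish hn hI hp hv).1) (by norm_num)

theorem mem_sing_coordSection_iff (hn : 1 ≤ n)
    (hI : ∀ s : Fin (2 * n + 1), n ≤ (s : ℕ) + 1 → (s : ℕ) ≤ n + 1 → s ∈ I) {p : PSpace n} :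
    p ∈ Sing (coordSection n I) ↔
      p ∈ coordSection n I ∧ ∀ s ∈ I, s.rev ∈ I → p.rep s = 0 := by
  refine and_congr_right fun hp => ⟨fun h => ?_, fun h =>
    (hasMultiplicity_coordSection_of_vanish hn hI hp h).2⟩
  by_contra hv
  exact h (hasMultiplicity_coordSection_of_not_vanish hn hI hp hv).2

end Global

end LocalAlgebra

/-! ### The bilinear form and the group -/

/-- The symmetric bilinear form with anti-diagonal matrix. -/
def bil {n : ℕ} (x y : Fin (2 * n + 1) → ℂ) : ℂ := ∑ s, x s * y s.rev

section Bil

variable {n : ℕ} (x y z : Fin (2 * n + 1) → ℂ) (c : ℂ)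

theorem bil_comm : bil x y = bil y x := by
  unfold bil
  rw [← Equiv.sum_comp Fin.revPerm]
  exact Finset.sum_congr rfl fun s _ => by simp [mul_comm]

theorem bil_add_left : bil (x + y) z = bil x z + bil y z := by
  simp [bil, add_mul, Finset.sum_add_distrib]

theorem bil_add_right : bil x (y + z) = bil x y + bil x z := by
  simp [bil, mul_add, Finset.sum_add_distrib]

theorem bil_smul_left : bil (c • x) y = c * bil x y := by
  simp [bil, Finset.mul_sum, mul_assoc]

theorem bil_smul_right : bil x (c • y) = c * bil x y := by
  rw [bil_comm, bil_smul_left, bil_comm]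

theorem bil_single_left (k : Fin (2 * n + 1)) : bil (Pi.single k 1) y = y k.rev := by
  unfold bil
  rw [Finset.sum_eq_single k]
  · simp
  · intro s _ hs; simp [hs]
  · simp

theorem bil_single_right (k : Fin (2 * n + 1)) : bil x (Pi.single k 1) = x k.rev := by
  rw [bil_comm, bil_single_left]

theorem Q_eq_bil : Q n x = bil x x := Q_eq_sum n x

theorem Q_add : Q n (x + y) = Q n x + 2 * bil x y + Q n y := by
  simp only [Q_eq_bil, bil_add_left, bil_add_right, bil_comm y x]
  ring

end Bil

section Group

variable {n : ℕ}

local notation "SL" => Matrix.SpecialLinearGroup (Fin (2 * n + 1)) ℂ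

theorem antiDiag_mulVec (x : Fin (2 * n + 1) → ℂ) : antiDiag n *ᵥ x = fun s => x s.rev := by
  ext s
  simp [antiDiag, Matrix.mulVec, dotProduct]

theorem bil_eq_dotProduct (x y : Fin (2 * n + 1) → ℂ) : bil x y = x ⬝ᵥ (antiDiag n *ᵥ y) := by
  rw [antiDiag_mulVec]; rfl

theorem mem_SO_iff {g : SL} : g ∈ SO n ↔
    ∀ i j, bil (g.1.col i) (g.1.col j) = if j = i.rev then 1 else 0 := by
  have h : ∀ i j, (g.1ᵀ * antiDiag n * g.1) i j = bil (g.1.col i) (g.1.col j) := by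
    intro i j
    rw [bil_eq_dotProduct, Matrix.mul_assoc]
    rfl
  constructor
  · intro hg i j
    rw [← h, show g.1ᵀ * antiDiag n * g.1 = antiDiag n from hg]
    rfl
  · intro hg
    change g.1ᵀ * antiDiag n * g.1 = antiDiag n
    ext i j
    rw [h, hg]
    rfl

theorem Q_mulVec {g : SL} (hg : g ∈ SO n) (x : Fin (2 * n + 1) → ℂ) :
    Q n (g.1 *ᵥ x) = Q n x := by
  rw [Q_eq_bil, Q_eq_bil, bil_eq_dotProduct, bil_eq_dotProduct, Matrix.mulVec_mulVec,
    ← Matrix.vecMul_transpose, ← Matrix.dotProduct_mulVec, Matrix.mulVec_mulVec,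
    ← Matrix.mul_assoc, show g.1ᵀ * antiDiag n * g.1 = antiDiag n from hg]

theorem mulVec_ne_zero (g : SL) {x : Fin (2 * n + 1) → ℂ} (hx : x ≠ 0) : g.1 *ᵥ x ≠ 0 :=
  (smul_ne_zero_iff_ne g).2 hx

theorem single_ne_zero' (k : Fin (2 * n + 1)) : (Pi.single k 1 : Fin (2 * n + 1) → ℂ) ≠ 0 := by
  simp

theorem smul_basisPoint (g : SL) (k : Fin (2 * n + 1)) (h : g.1.col k ≠ 0) :
    g • basisPoint n k = Projectivization.mk ℂ (g.1.col k) h := by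
  rw [basisPoint, Projectivization.smul_mk]
  congr 1
  exact Matrix.mulVec_single_one _ _

theorem col_ne_zero (g : SL) (k : Fin (2 * n + 1)) : g.1.col k ≠ 0 := by
  rw [← Matrix.mulVec_single_one]
  exact mulVec_ne_zero g (single_ne_zero' k)

theorem Q_single {k : Fin (2 * n + 1)} (hk : k ≠ mid n) :
    Q n (Pi.single k 1) = 0 := by
  rw [Q_eq_bil, bil_single_left, Pi.single_eq_of_ne]
  exact fun h => hk (rev_eq_self_iff.1 h)

/-! ### Eichler transformations -/

/-- The matrix of the Eichler transformation attached to `e_{k'}` and a vector `w`. -/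
def eichler (k : Fin (2 * n + 1)) (w : Fin (2 * n + 1) → ℂ) :
    Matrix (Fin (2 * n + 1)) (Fin (2 * n + 1)) ℂ :=
  Matrix.of fun r c => ((Pi.single c 1 : Fin (2 * n + 1) → ℂ) + (if c = k then (1 : ℂ) else 0) • w +
    (-w c.rev - bil w w / 2 * (if c = k then 1 else 0)) •
      (Pi.single k.rev 1 : Fin (2 * n + 1) → ℂ)) r

theorem eichler_col (k c : Fin (2 * n + 1)) (w : Fin (2 * n + 1) → ℂ) :
    (eichler k w).col c = (Pi.single c 1 : Fin (2 * n + 1) → ℂ) +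
      (if c = k then (1 : ℂ) else 0) • w +
      (-w c.rev - bil w w / 2 * (if c = k then 1 else 0)) •
        (Pi.single k.rev 1 : Fin (2 * n + 1) → ℂ) := rfl

variable {k : Fin (2 * n + 1)} {w : Fin (2 * n + 1) → ℂ}

/-- The map is `x ↦ x + x_k w - (bil x w + x_k bil w w / 2) e_{k.rev}`. It is an isometry because
`e_{k.rev}` is isotropic and orthogonal to `w`, the latter being `w k = 0`. -/
theorem bil_eichler (hk : k ≠ mid n) (hwk : w k = 0) (i j : Fin (2 * n + 1)) :
    bil ((eichler k w).col i) ((eichler k w).col j) = if j = i.rev then 1 else 0 := by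
  have hkr : k ≠ k.rev := fun h => hk (rev_eq_self_iff.1 h.symm)
  have h1 : ∀ i : Fin (2 * n + 1), (Pi.single k.rev 1 : Fin (2 * n + 1) → ℂ) i.rev =
      if i = k then 1 else 0 := fun i => by simp [Pi.single_apply]
  have h3 : ∀ i : Fin (2 * n + 1), (Pi.single i 1 : Fin (2 * n + 1) → ℂ) k =
      if i = k then 1 else 0 := fun i => by simp [Pi.single_apply, eq_comm]
  have h4 : (Pi.single i 1 : Fin (2 * n + 1) → ℂ) j.rev = if j = i.rev then 1 else 0 := by
    simp only [Pi.single_apply, Fin.rev_eq_iff]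
  simp only [eichler_col, bil_add_left, bil_add_right, bil_smul_left, bil_smul_right,
    bil_single_left, bil_single_right, Pi.add_apply, Pi.smul_apply, smul_eq_mul, h1, h3, h4,
    Fin.rev_rev, hwk, if_neg hkr.symm]
  ring

section Order

variable {R : Fin (2 * n + 1) → Fin (2 * n + 1) → Prop}

/-- The relation `R` is abstract so that `<` and `>` give the upper and lower triangular cases at
once. -/
theorem eichler_triangular [IsStrictOrder (Fin (2 * n + 1)) R] (hR : ∀ a b, R a b → R b.rev a.rev)
    (hw : ∀ r, w r ≠ 0 → R r k) {r c : Fin (2 * n + 1)} (hrc : R c r) :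
    eichler k w r c = 0 := by
  have hcr : r ≠ c := by rintro rfl; exact irrefl_of R _ hrc
  have h1 : (if c = k then (1 : ℂ) else 0) * w r = 0 := by
    split_ifs with h
    · rw [one_mul]
      by_contra hwr
      exact asymm_of R hrc (h ▸ hw r hwr)
    · rw [zero_mul]
  have h2 : (-w c.rev - bil w w / 2 * (if c = k then 1 else 0)) *
      (Pi.single k.rev 1 : Fin (2 * n + 1) → ℂ) r = 0 := by
    by_cases hr : r = k.rev
    · have h3 : w c.rev = 0 := by
        by_contra hwc
        have := hR _ _ (hw _ hwc)
        rw [Fin.rev_rev] at this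
        exact asymm_of R hrc (hr ▸ this)
      rw [h3]
      split_ifs with h
      -- A nonzero term would put both `s` and `s.rev` before `k`, hence `k.rev` before `k`, against
      -- the assumed order.
      · have hβ : bil w w = 0 := by
          refine Finset.sum_eq_zero fun s _ => ?_
          by_contra hs
          have hs1 := hR _ _ (hw s (left_ne_zero_of_mul hs))
          have hs2 := hw _ (right_ne_zero_of_mul hs)
          have := trans_of R hs1 hs2
          rw [h, hr] at hrc
          exact asymm_of R hrc this
        simp [hβ]
      · simp
    · rw [Pi.single_eq_of_ne hr, mul_zero]
  change (Pi.single c 1 : Fin (2 * n + 1) → ℂ) r + _ * w r + _ * _ = 0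
  rw [Pi.single_eq_of_ne hcr, h1, h2]
  simp

theorem eichler_diag (hwk : w k = 0) (hk : k ≠ mid n)
    (s : Fin (2 * n + 1)) : eichler k w s s = 1 := by
  have h1 : (if s = k then (1 : ℂ) else 0) * w s = 0 := by
    split_ifs with h
    · rw [h, hwk, mul_zero]
    · rw [zero_mul]
  have h2 : (-w s.rev - bil w w / 2 * (if s = k then 1 else 0)) *
      (Pi.single k.rev 1 : Fin (2 * n + 1) → ℂ) s = 0 := by
    by_cases hr : s = k.rev
    · have hsk : s ≠ k := by rw [hr]; exact fun h => hk (rev_eq_self_iff.1 h)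
      rw [hr, Fin.rev_rev, hwk, if_neg (hr ▸ hsk)]
      simp
    · rw [Pi.single_eq_of_ne hr, mul_zero]
  change (Pi.single s 1 : Fin (2 * n + 1) → ℂ) s + _ * w s + _ * _ = 1
  rw [Pi.single_eq_same, h1, h2]
  simp

/-- An isotropic vector with nonzero coordinate `k`, supported on indices up to `k` for an
order compatible with reversal, is up to a scalar the image of `e_k` under a triangular
element of `SO(V)`. -/
theorem exists_triangular_col_eq [IsStrictOrder (Fin (2 * n + 1)) R]
    (hR : ∀ a b, R a b → R b.rev a.rev)
    (hk : k ≠ mid n)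
    (hdet : ∀ M : Matrix (Fin (2 * n + 1)) (Fin (2 * n + 1)) ℂ,
      (∀ r c, R c r → M r c = 0) → M.det = ∏ s, M s s)
    {v : Fin (2 * n + 1) → ℂ} (hvk : v k = 1) (hvQ : Q n v = 0)
    (hv : ∀ r, r ≠ k → v r ≠ 0 → R r k) :
    ∃ g : SL, g ∈ SO n ∧ (∀ r c, R c r → g.1 r c = 0) ∧ g.1.col k = v := by
  have hkr : k ≠ k.rev := fun h => hk (rev_eq_self_iff.1 h.symm)
  let w : Fin (2 * n + 1) → ℂ := fun s => if s = k ∨ s = k.rev then 0 else v s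
  have hwk : w k = 0 := by simp [w]
  have hwk' : w k.rev = 0 := by simp [w]
  have hw : ∀ r, w r ≠ 0 → R r k := by
    intro r hr
    simp only [w] at hr
    split_ifs at hr with h
    · exact absurd rfl hr
    · exact hv r (fun h' => h (Or.inl h')) hr
  have htri : ∀ r c, R c r → eichler k w r c = 0 := fun r c h =>
    eichler_triangular hR hw h
  have hd : (eichler k w).det = 1 := by
    rw [hdet _ htri, Finset.prod_eq_one fun s _ => eichler_diag hwk hk s]
  refine ⟨⟨eichler k w, hd⟩, mem_SO_iff.2 (bil_eichler hk hwk), htri, ?_⟩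
  have hvw : v = (Pi.single k 1 : Fin (2 * n + 1) → ℂ) + w +
      v k.rev • (Pi.single k.rev 1 : Fin (2 * n + 1) → ℂ) := by
    ext s
    by_cases h1 : s = k
    · subst h1; simp [hwk, hvk, hkr]
    · by_cases h2 : s = k.rev
      · subst h2; simp [hwk', hkr.symm]
      · simp [w, h1, h2]
  -- Isotropy of `v` forces its last free coordinate to be the one that the Eichler transformation
  -- produces.
  have hβ : v k.rev = - (bil w w / 2) := by
    rw [hvw, Q_eq_bil] at hvQ
    simp only [bil_add_left, bil_add_right, bil_smul_left, bil_smul_right, bil_single_left,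
      bil_single_right, Pi.add_apply, Pi.smul_apply, smul_eq_mul, hwk, hwk', Fin.rev_rev,
      Pi.single_eq_same, Pi.single_eq_of_ne hkr.symm,
      Pi.single_eq_of_ne hkr] at hvQ
    linear_combination hvQ / 2
  change (eichler k w).col k = v
  rw [eichler_col, hvw, if_pos rfl, hwk', hβ]
  simp

end Order

/-- A point of the quadric as in `exists_triangular_col_eq`, in the orbit of `[e_k]`. -/
theorem mem_orbit_of_support {H : Subgroup SL} {R : Fin (2 * n + 1) → Fin (2 * n + 1) → Prop}
    [IsStrictOrder (Fin (2 * n + 1)) R] (hR : ∀ a b, R a b → R b.rev a.rev)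
    (hH : ∀ g : SL, g ∈ SO n → (∀ r c, R c r → g.1 r c = 0) → g ∈ H)
    (hk : k ≠ mid n)
    (hdet : ∀ M : Matrix (Fin (2 * n + 1)) (Fin (2 * n + 1)) ℂ,
      (∀ r c, R c r → M r c = 0) → M.det = ∏ s, M s s)
    {v : Fin (2 * n + 1) → ℂ} (hv0 : v ≠ 0) (hvk : v k ≠ 0) (hvQ : Q n v = 0)
    (hv : ∀ r, r ≠ k → v r ≠ 0 → R r k) :
    Projectivization.mk ℂ v hv0 ∈ MulAction.orbit H (basisPoint n k) := by
  obtain ⟨g, hg, hgt, hgk⟩ := exists_triangular_col_eq (v := (v k)⁻¹ • v) hR hk hdet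
    (by simp [hvk]) (by rw [Q_smul, hvQ, mul_zero])
    (fun r hr h => hv r hr (by simpa [hvk] using h))
  refine ⟨⟨g, hH g hg hgt⟩, ?_⟩
  change g • basisPoint n k = _
  rw [smul_basisPoint g k (col_ne_zero g k), Projectivization.mk_eq_mk_iff']
  exact ⟨(v k)⁻¹, hgk.symm⟩

theorem mem_orbit_borel (hk : k ≠ mid n) {v : Fin (2 * n + 1) → ℂ} (hv0 : v ≠ 0) (hvk : v k ≠ 0)
    (hvQ : Q n v = 0) (hv : ∀ r, k < r → v r = 0) :
    Projectivization.mk ℂ v hv0 ∈ MulAction.orbit (borel n) (basisPoint n k) := by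
  refine mem_orbit_of_support (H := borel n) (R := (· < ·)) (fun a b h => Fin.rev_lt_rev.2 h)
    (fun g hg h => ⟨hg, fun r c hrc => h r c hrc⟩) hk
    (fun M hM => Matrix.det_of_isUpperTriangular fun r c hrc => hM r c hrc) hv0 hvk hvQ ?_
  intro r hr hvr
  exact lt_of_le_of_ne (not_lt.1 fun h => hvr (hv r h)) hr

theorem mem_orbit_oppBorel (hk : k ≠ mid n) {v : Fin (2 * n + 1) → ℂ} (hv0 : v ≠ 0)
    (hvk : v k ≠ 0) (hvQ : Q n v = 0) (hv : ∀ r, r < k → v r = 0) :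
    Projectivization.mk ℂ v hv0 ∈ MulAction.orbit (oppBorel n) (basisPoint n k) := by
  refine mem_orbit_of_support (H := oppBorel n) (R := (· > ·)) (fun a b h => Fin.rev_lt_rev.2 h)
    (fun g hg h => ⟨hg, fun r c hrc => h c r hrc⟩) hk
    (fun M hM => Matrix.det_of_isLowerTriangular M fun r c hrc => hM r c hrc) hv0 hvk hvQ ?_
  intro r hr hvr
  exact lt_of_le_of_ne (not_lt.1 fun h => hvr (hv r h)) hr.symm

end Group

variable {n : ℕ}

local notation "SL" => Matrix.SpecialLinearGroup (Fin (2 * n + 1)) ℂ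

/-! ### Monomial matrices -/

/-- The sign put on the middle basis vector to make the determinant one. -/
def monomialSign (π : Equiv.Perm (Fin (2 * n + 1))) (c : Fin (2 * n + 1)) : ℂ :=
  if c = mid n then ((Equiv.Perm.sign π : ℤ) : ℂ) else 1

theorem sign_mul_self (π : Equiv.Perm (Fin (2 * n + 1))) :
    ((Equiv.Perm.sign π : ℤ) : ℂ) * ((Equiv.Perm.sign π : ℤ) : ℂ) = 1 := by
  rcases Int.units_eq_one_or (Equiv.Perm.sign π) with h | h <;> simp [h]

theorem monomialSign_ne_zero (π : Equiv.Perm (Fin (2 * n + 1))) (c : Fin (2 * n + 1)) :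
    monomialSign π c ≠ 0 := by
  unfold monomialSign
  split_ifs
  · exact left_ne_zero_of_mul_eq_one (sign_mul_self π)
  · exact one_ne_zero

/-- The monomial matrix `e_c ↦ ± e_{π c}`. -/
def monomialMatrix (π : Equiv.Perm (Fin (2 * n + 1))) :
    Matrix (Fin (2 * n + 1)) (Fin (2 * n + 1)) ℂ :=
  Equiv.Perm.permMatrix ℂ π⁻¹ * Matrix.diagonal (monomialSign π)

theorem monomialMatrix_apply (π : Equiv.Perm (Fin (2 * n + 1))) (r c : Fin (2 * n + 1)) :
    monomialMatrix π r c = if r = π c then monomialSign π c else 0 := by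
  have h : Equiv.Perm.permMatrix ℂ π⁻¹ r c = if r = π c then 1 else 0 := by
    simp [Equiv.Perm.permMatrix, PEquiv.toMatrix_apply, Equiv.symm_apply_eq]
  rw [monomialMatrix, Matrix.mul_diagonal, h, ite_mul, one_mul, zero_mul]

/-- The monomial matrix of a permutation as an element of the special linear group. -/
def monomialSL (π : Equiv.Perm (Fin (2 * n + 1))) : SL :=
  ⟨monomialMatrix π, by
    rw [monomialMatrix, Matrix.det_mul, Matrix.det_permutation, Matrix.det_diagonal]
    simp only [monomialSign, Finset.prod_ite_eq', Finset.mem_univ, if_true, Equiv.Perm.sign_inv]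
    exact sign_mul_self π⟩

theorem monomialSL_col (π : Equiv.Perm (Fin (2 * n + 1))) (c : Fin (2 * n + 1)) :
    (monomialSL π).1.col c = monomialSign π c • (Pi.single (π c) 1 : Fin (2 * n + 1) → ℂ) := by
  ext r
  change monomialMatrix π r c = _
  rw [monomialMatrix_apply]
  simp [Pi.single_apply]

/-- Commuting with the reversal preserves mirror pairs. The determinant-correcting sign sits on the
middle vector, which pairs with itself, so the sign is squared away. -/
theorem monomialSL_mem_SO {π : Equiv.Perm (Fin (2 * n + 1))} (hπ : ∀ s, π s.rev = (π s).rev) :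
    monomialSL π ∈ SO n := by
  rw [mem_SO_iff]
  intro i j
  rw [monomialSL_col, monomialSL_col, bil_smul_left, bil_smul_right, bil_single_left,
    Pi.single_apply, ← hπ]
  simp only [EmbeddingLike.apply_eq_iff_eq]
  by_cases hj : j = i.rev
  · subst hj
    have hmid : i.rev = mid n ↔ i = mid n := by rw [Fin.rev_eq_iff, rev_mid]
    simp only [if_true, monomialSign, hmid]
    split_ifs
    · rw [mul_one, sign_mul_self]
    · norm_num
  · rw [if_neg hj, if_neg fun h => hj h.symm, mul_zero, mul_zero]

theorem mem_torus_iff {t : SL} : t ∈ torus n ↔ t ∈ SO n ∧ ∀ i j, i ≠ j → t.1 i j = 0 := by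
  constructor
  · rintro ⟨⟨h1, h2⟩, ⟨-, h3⟩⟩
    refine ⟨h1, fun i j hij => ?_⟩
    rcases lt_or_gt_of_ne hij with h | h
    · exact h3 h
    · exact h2 h
  · rintro ⟨h1, h2⟩
    exact ⟨⟨h1, fun i j h => h2 i j (ne_of_gt h)⟩, ⟨h1, fun i j h => h2 j i (ne_of_lt h)⟩⟩

/-- Conjugation permutes the matrix entries up to nonzero factors and keeps off-diagonal positions
off the diagonal. -/
theorem monomialSL_mem_normalizer {π : Equiv.Perm (Fin (2 * n + 1))}
    (hπ : ∀ s, π s.rev = (π s).rev) :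
    monomialSL π ∈ Subgroup.normalizer (torus n : Set SL) := by
  rw [Subgroup.mem_normalizer_iff]
  intro h
  have hg := monomialSL_mem_SO hπ
  set g := monomialSL π
  have hSO : h ∈ SO n ↔ g * h * g⁻¹ ∈ SO n := by
    rw [Subgroup.mul_mem_cancel_right _ (inv_mem hg), Subgroup.mul_mem_cancel_left _ hg]
  have hmul : (g * h * g⁻¹).1 * g.1 = g.1 * h.1 := by
    rw [← Matrix.SpecialLinearGroup.coe_mul, ← Matrix.SpecialLinearGroup.coe_mul,
      inv_mul_cancel_right]
  have hentry : ∀ r c, (g * h * g⁻¹).1 (π r) (π c) * monomialSign π c =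
      monomialSign π r * h.1 r c := by
    intro r c
    have := congrFun (congrFun hmul (π r)) c
    rw [Matrix.mul_apply, Matrix.mul_apply] at this
    change ∑ j, _ * monomialMatrix π j c = ∑ j, monomialMatrix π (π r) j * _ at this
    simpa [monomialMatrix_apply] using this
  rw [mem_torus_iff, mem_torus_iff, hSO]
  refine and_congr_right fun _ => ⟨fun H i j hij => ?_, fun H i j hij => ?_⟩
  · have := hentry (π.symm i) (π.symm j)
    rw [H _ _ (fun h => hij (π.symm.injective h)), mul_zero, Equiv.apply_symm_apply,
      Equiv.apply_symm_apply] at this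
    exact (mul_eq_zero.1 this).resolve_right (monomialSign_ne_zero π _)
  · have := hentry i j
    rw [H _ _ (fun h => hij (π.injective h)), zero_mul] at this
    exact (mul_eq_zero.1 this.symm).resolve_left (monomialSign_ne_zero π _)

theorem exists_perm_commuting_rev (hn : 1 ≤ n) {k : Fin (2 * n + 1)} (hk : k ≠ mid n) :
    ∃ π : Equiv.Perm (Fin (2 * n + 1)), (∀ s, π s.rev = (π s).rev) ∧ π 0 = k := by
  have hconj : ∀ (a b s : Fin (2 * n + 1)),
      Equiv.swap a b s.rev = (Equiv.swap a.rev b.rev s).rev := by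
    intro a b s
    simp only [Equiv.swap_apply_def, Fin.rev_eq_iff]
    split_ifs <;> simp
  by_cases h : k = Fin.rev 0
  · refine ⟨Equiv.swap 0 k, fun s => ?_, Equiv.swap_apply_left _ _⟩
    rw [hconj, h, Fin.rev_rev, Equiv.swap_comm]
  · have h0 : (0 : Fin (2 * n + 1)) ≠ Fin.rev 0 := by
      simp only [Ne, Fin.ext_iff, Fin.val_rev, Fin.val_zero]
      omega
    have hkr : k ≠ k.rev := fun h => hk (rev_eq_self_iff.1 h.symm)
    have h0k : (0 : Fin (2 * n + 1)) ≠ k.rev := fun h' => h (by rw [h', Fin.rev_rev])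
    -- Reversal exchanges the two transpositions, so their product commutes with it because they
    -- commute with each other.
    refine ⟨Equiv.swap 0 k * Equiv.swap (Fin.rev 0) k.rev, fun s => ?_, ?_⟩
    · have hcomm : Equiv.swap 0 k * Equiv.swap (Fin.rev 0) k.rev =
          Equiv.swap (Fin.rev 0) k.rev * Equiv.swap 0 k := by
        by_cases hk0 : k = 0
        · subst hk0; simp
        · refine Equiv.Perm.Disjoint.commute fun s => ?_
          by_cases hs : s = 0 ∨ s = k
          · right
            rcases hs with rfl | rfl
            · exact Equiv.swap_apply_of_ne_of_ne h0 h0k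
            · exact Equiv.swap_apply_of_ne_of_ne h hkr
          · left
            rw [not_or] at hs
            exact Equiv.swap_apply_of_ne_of_ne hs.1 hs.2
      conv_lhs => rw [hcomm]
      rw [Equiv.Perm.mul_apply, Equiv.Perm.mul_apply, hconj, hconj, Fin.rev_rev, Fin.rev_rev]
    · rw [Equiv.Perm.mul_apply, Equiv.swap_apply_of_ne_of_ne h0 h0k, Equiv.swap_apply_left]

theorem exists_weyl_smul_eq (hn : 1 ≤ n) {k : Fin (2 * n + 1)} (hk : k ≠ mid n) :
    ∃ g : SL, g ∈ SO n ⊓ Subgroup.normalizer (torus n : Set SL) ∧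
      basisPoint n k = g • basisPoint n 0 := by
  obtain ⟨π, hπ, hπ0⟩ := exists_perm_commuting_rev hn hk
  refine ⟨monomialSL π, ⟨monomialSL_mem_SO hπ, monomialSL_mem_normalizer hπ⟩, ?_⟩
  rw [smul_basisPoint _ _ (col_ne_zero _ _), basisPoint, eq_comm, Projectivization.mk_eq_mk_iff']
  exact ⟨monomialSign π 0, by rw [monomialSL_col, hπ0]⟩

/-! ### The quadric as a homogeneous space -/

theorem mk_mem_quadric {v : Fin (2 * n + 1) → ℂ} (hv : v ≠ 0) :
    Projectivization.mk ℂ v hv ∈ quadric n ↔ Q n v = 0 := by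
  have h : quadric n = coordSection n Set.univ := by
    ext p
    exact ⟨fun h => ⟨h, fun s hs => absurd trivial hs⟩, fun h => h.1⟩
  rw [h, mk_mem_coordSection]
  exact ⟨fun h => h.1, fun h => ⟨h, fun s hs => absurd trivial hs⟩⟩

theorem smul_mem_quadric {g : SL} (hg : g ∈ SO n) {p : PSpace n} (hp : p ∈ quadric n) :
    g • p ∈ quadric n := by
  induction p using Projectivization.ind with
  | h v hv =>
    rw [mk_mem_quadric] at hp
    have : g • Projectivization.mk ℂ v hv =
      Projectivization.mk ℂ (g.1 *ᵥ v) (mulVec_ne_zero g hv) := rfl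
    rw [this, mk_mem_quadric, Q_mulVec hg, hp]

theorem basisPoint_mem_quadric {k : Fin (2 * n + 1)} :
    basisPoint n k ∈ quadric n ↔ k ≠ mid n := by
  rw [basisPoint, mk_mem_quadric]
  refine ⟨?_, Q_single⟩
  rintro h rfl
  rw [Q_eq_bil, bil_single_left, rev_mid, Pi.single_eq_same] at h
  exact one_ne_zero h

/-- Take the largest index in the support. Were it the middle one, `Q n v` would reduce to the
square of that coordinate. -/
theorem exists_leading {v : Fin (2 * n + 1) → ℂ} (hv : v ≠ 0) (hQ : Q n v = 0) :
    ∃ k, k ≠ mid n ∧ v k ≠ 0 ∧ ∀ r, k < r → v r = 0 := by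
  classical
  have hne : (Finset.univ.filter fun s => v s ≠ 0).Nonempty := by
    obtain ⟨s, hs⟩ := Function.ne_iff.1 hv
    exact ⟨s, by simpa using hs⟩
  obtain ⟨k, hk, hmax⟩ := Finset.exists_max_image _ id hne
  have hvk : v k ≠ 0 := by simpa using hk
  have hlead : ∀ r, k < r → v r = 0 := by
    intro r hr
    by_contra h
    exact absurd (hmax r (by simpa using h)) (not_le.2 hr)
  refine ⟨k, ?_, hvk, hlead⟩
  rintro rfl
  rw [Q_eq_sum, Finset.sum_eq_single (mid n)] at hQ
  · rw [rev_mid] at hQ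
    exact hvk (mul_self_eq_zero.1 hQ)
  · intro s _ hs
    rcases lt_or_gt_of_ne hs with h | h
    · rw [hlead s.rev (by rw [← rev_mid n]; exact Fin.rev_lt_rev.2 h), mul_zero]
    · rw [hlead s h, zero_mul]
  · simp

/-- Injectivity is orbit–stabilizer. Surjectivity is the Bruhat decomposition: a Weyl element
reaches `[e_k]`, for `k` the leading index, and the Borel subgroup reaches the point from there. -/
theorem bijOn_quotientMap (hn : 1 ≤ n) : Set.BijOn (quotientMap n) Set.univ (quadric n) := by
  have h0 : (0 : Fin (2 * n + 1)) ≠ mid n := by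
    simp only [Ne, Fin.ext_iff, mid, Fin.val_zero]
    omega
  refine ⟨?_, (MulAction.injective_ofQuotientStabilizer (SO n) (basisPoint n 0)).injOn, ?_⟩
  · intro q _
    induction q using QuotientGroup.induction_on with
    | H g => exact smul_mem_quadric g.2 (basisPoint_mem_quadric.2 h0)
  · intro p hp
    induction p using Projectivization.ind with
    | h v hv =>
      rw [mk_mem_quadric] at hp
      obtain ⟨k, hk, hvk, hlead⟩ := exists_leading hv hp
      obtain ⟨b, hb⟩ := mem_orbit_borel hk hv hvk hp hlead
      obtain ⟨w, hw, hwk⟩ := exists_weyl_smul_eq hn hk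
      refine ⟨((⟨b.1, b.2.1⟩ * ⟨w, hw.1⟩ : SO n) : SO n ⧸ _), trivial, ?_⟩
      rw [← hb]
      change (b.1 * w) • basisPoint n 0 = b.1 • basisPoint n k
      rw [hwk, mul_smul]

theorem exists_regular_torus_element (n : ℕ) :
    ∃ t : Matrix.SpecialLinearGroup (Fin (2 * n + 1)) ℂ, t ∈ torus n ∧
      ∀ i j, t.1 i i = t.1 j j → i = j := by
  let a : Fin (2 * n + 1) → ℂ := fun s => (2 : ℂ) ^ ((n : ℤ) - (s : ℕ))
  have ha : ∀ s, a s * a s.rev = 1 := by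
    intro s
    rw [← zpow_add₀ two_ne_zero]
    have : (n : ℤ) - (s : ℕ) + ((n : ℤ) - (s.rev : ℕ)) = 0 := by
      rw [Fin.val_rev]; omega
    rw [this, zpow_zero]
  -- Squaring lets the determinant be computed by pairing one factor `a s` with the mirrored other
  -- one; the entries stay distinct powers of 4.
  let d : Fin (2 * n + 1) → ℂ := fun s => a s * a s
  have hdet : (Matrix.diagonal d).det = 1 := by
    rw [Matrix.det_diagonal, Finset.prod_mul_distrib]
    nth_rewrite 2 [← Equiv.prod_comp Fin.revPerm]
    rw [← Finset.prod_mul_distrib]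
    exact Finset.prod_eq_one fun s _ => ha s
  refine ⟨⟨Matrix.diagonal d, hdet⟩, mem_torus_iff.2 ⟨mem_SO_iff.2 fun i j => ?_,
    fun i j h => Matrix.diagonal_apply_ne _ h⟩, fun i j h => ?_⟩
  · have hcol : ∀ c, (Matrix.diagonal d).col c = d c • (Pi.single c 1 : Fin (2 * n + 1) → ℂ) := by
      intro c
      ext r
      by_cases h : r = c
      · subst h; simp
      · simp [h]
    change bil ((Matrix.diagonal d).col i) ((Matrix.diagonal d).col j) = _
    rw [hcol, hcol, bil_smul_left, bil_smul_right, bil_single_left, Pi.single_apply]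
    by_cases hj : j = i.rev
    · subst hj
      simp only [if_true, d]
      linear_combination (a i * a i.rev + 1) * ha i
    · rw [if_neg hj, if_neg fun h => hj h.symm, mul_zero, mul_zero]
  · change Matrix.diagonal d i i = Matrix.diagonal d j j at h
    rw [Matrix.diagonal_apply_eq, Matrix.diagonal_apply_eq] at h
    have h1 := congrArg norm h
    simp only [d, a, norm_mul, norm_zpow, Complex.norm_ofNat] at h1
    rw [← zpow_add₀ two_ne_zero, ← zpow_add₀ two_ne_zero] at h1
    have h2 := zpow_right_injective₀ (two_pos (α := ℝ)) (by norm_num) h1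
    ext
    omega

/-- For `τ` in the normalizer and `t` in the torus, `τ⁻¹ * t * τ` is diagonal, so the first column
of `τ` is an eigenvector of `t`. Choosing `t` with distinct eigenvalues makes it a multiple of a
basis vector, and isotropy excludes the middle one. -/
theorem torusFixedPoints_eq (hn : 1 ≤ n) :
    torusFixedPoints n = {p | ∃ k : Fin (2 * n + 1), k ≠ mid n ∧ p = basisPoint n k} := by
  ext p
  constructor
  · rintro ⟨τ, ⟨hτ, hτN⟩, rfl⟩
    obtain ⟨t, ht, htinj⟩ := exists_regular_torus_element n
    have ht' := (mem_torus_iff.1 ((Subgroup.mem_normalizer_iff.1 (inv_mem hτN) t).1 ht)).2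
    rw [inv_inv] at ht'
    have htd := (mem_torus_iff.1 ht).2
    have hmul : t.1 * τ.1 = τ.1 * (τ⁻¹ * t * τ).1 := by
      rw [← Matrix.SpecialLinearGroup.coe_mul, ← Matrix.SpecialLinearGroup.coe_mul,
        mul_assoc τ⁻¹, mul_inv_cancel_left]
    have heig : ∀ s, t.1 s s * τ.1 s 0 = τ.1 s 0 * (τ⁻¹ * t * τ).1 0 0 := by
      intro s
      have h := congrFun (congrFun hmul s) 0
      rw [Matrix.mul_apply, Matrix.mul_apply, Finset.sum_eq_single s, Finset.sum_eq_single 0] at h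
      · exact h
      · intro b _ hb
        rw [ht' _ _ hb, mul_zero]
      · simp
      · intro b _ hb
        rw [htd _ _ hb.symm, zero_mul]
      · simp
    obtain ⟨k, hk⟩ := Function.ne_iff.1 (col_ne_zero τ 0)
    change τ.1 k 0 ≠ 0 at hk
    have hcol : τ.1.col 0 = τ.1 k 0 • (Pi.single k 1 : Fin (2 * n + 1) → ℂ) := by
      ext s
      by_cases hs : s = k
      · subst hs; simp
      · have : τ.1 s 0 = 0 := by
          by_contra h
          apply hs
          apply htinj
          have h1 := heig s
          have h2 := heig k
          rw [mul_comm] at h1 h2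
          rw [mul_left_cancel₀ h h1, mul_left_cancel₀ hk h2]
        simp [hs, this]
    have hp : τ • basisPoint n 0 = basisPoint n k := by
      rw [smul_basisPoint _ _ (col_ne_zero _ _), basisPoint, Projectivization.mk_eq_mk_iff']
      exact ⟨_, hcol.symm⟩
    refine ⟨k, ?_, hp⟩
    rw [← basisPoint_mem_quadric, ← hp]
    refine smul_mem_quadric hτ (basisPoint_mem_quadric.2 ?_)
    simp only [Ne, Fin.ext_iff, mid, Fin.val_zero]
    omega
  · rintro ⟨k, hk, rfl⟩
    obtain ⟨g, hg, h⟩ := exists_weyl_smul_eq hn hk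
    exact ⟨g, hg, h⟩

/-! ### Zariski closures of orbits -/

theorem eval_smul_eq_zero {σ : Type*} {f : MvPolynomial σ ℂ} {d : ℕ} (hf : f.IsHomogeneous d)
    {x : σ → ℂ} (c : ℂ) (h : MvPolynomial.eval x f = 0) : MvPolynomial.eval (c • x) f = 0 := by
  have key : MvPolynomial.eval (c • x) f = c ^ d * MvPolynomial.eval x f := by
    rw [MvPolynomial.eval_eq, MvPolynomial.eval_eq, Finset.mul_sum]
    refine Finset.sum_congr rfl fun m hm => ?_
    have hd : ∑ i ∈ m.support, m i = d := by
      exact (DFunLike.congr_fun (Finsupp.degree_eq_weight_one (R := ℕ)) m).trans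
        (hf (MvPolynomial.mem_support_iff.1 hm))
    simp only [Pi.smul_apply, smul_eq_mul, mul_pow, Finset.prod_mul_distrib,
      Finset.prod_pow_eq_pow_sum, hd]
    ring
  rw [key, h, mul_zero]

theorem eval_rep_mk_eq_zero_iff {σ : Type*} {f : MvPolynomial σ ℂ} {d : ℕ} (hf : f.IsHomogeneous d)
    {x : σ → ℂ} (hx : x ≠ 0) :
    MvPolynomial.eval (Projectivization.mk ℂ x hx).rep f = 0 ↔ MvPolynomial.eval x f = 0 := by
  obtain ⟨a, ha⟩ := Projectivization.exists_smul_eq_mk_rep ℂ x hx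
  rw [← ha]
  refine ⟨fun h => ?_, fun h => eval_smul_eq_zero hf (a : ℂ) h⟩
  have := eval_smul_eq_zero hf ((a⁻¹ : ℂˣ) : ℂ) h
  rwa [← Units.smul_def, inv_smul_smul] at this

theorem eval_curve_eq_zero {σ : Type*} (f : MvPolynomial σ ℂ) {γ : ℂ → σ → ℂ}
    (hγ : Continuous γ) {F : Set ℂ} (hF : F.Finite)
    (h : ∀ t ∉ F, MvPolynomial.eval (γ t) f = 0) (t : ℂ) : MvPolynomial.eval (γ t) f = 0 := by
  have hcont : Continuous fun t => MvPolynomial.eval (γ t) f :=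
    (MvPolynomial.continuous_eval f).comp hγ
  have hdense : Dense (Set.univ \ F : Set ℂ) := dense_univ.sdiff_finite hF
  have hclosed : IsClosed {t | MvPolynomial.eval (γ t) f = 0} :=
    isClosed_singleton.preimage hcont
  have hsub : closure (Set.univ \ F) ⊆ {t | MvPolynomial.eval (γ t) f = 0} :=
    hclosed.closure_subset_iff.2 fun t ht => h t ht.2
  exact hsub (hdense t)

/-- Density of the part `v k ≠ 0` in the cone over the section: each remaining point is the value at
0 of a curve in the cone that meets `v k = 0` for finitely many parameters only. -/
theorem eval_eq_zero_of_open_part {I : Set (Fin (2 * n + 1))} {k : Fin (2 * n + 1)} (hkI : k ∈ I)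
    (hk : k ≠ mid n) (hmid : k.rev ∈ I → mid n ∈ I) {f : MvPolynomial (Fin (2 * n + 1)) ℂ}
    (hf : ∀ v, Q n v = 0 → (∀ s ∉ I, v s = 0) → v k ≠ 0 → MvPolynomial.eval v f = 0)
    {v : Fin (2 * n + 1) → ℂ} (hQ : Q n v = 0) (hv : ∀ s ∉ I, v s = 0) :
    MvPolynomial.eval v f = 0 := by
  have hkr : k ≠ k.rev := fun h => hk (rev_eq_self_iff.1 h.symm)
  by_cases hvk : v k = 0
  swap
  · exact hf v hQ hv hvk
  by_cases hvr : v k.rev = 0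
  · let γ : ℂ → Fin (2 * n + 1) → ℂ := fun t => v + t • Pi.single k 1
    have hγ : Continuous γ := by fun_prop
    have := eval_curve_eq_zero f hγ (Set.finite_singleton 0) (fun t ht => by
      refine hf _ ?_ (fun s hs => ?_) ?_
      · rw [Q_add, Q_smul, Q_single hk, hQ, bil_smul_right, bil_single_right, hvr]
        ring
      · have : s ≠ k := by rintro rfl; exact hs hkI
        simp [γ, hv s hs, this]
      · simpa [γ, hvk] using ht) 0
    simpa [γ] using this
  · have hmI : mid n ∈ I := hmid (by by_contra h; exact hvr (hv _ h))
    -- Moving along `e_k` alone would leave the quadric, so the middle coordinate moves by `t`, and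
    -- `b t` solves the remaining equation, linear in the `k`-th coordinate. It vanishes only at the
    -- two excluded parameters.
    let b : ℂ → ℂ := fun t => -(t ^ 2 + 2 * t * v (mid n)) / (2 * v k.rev)
    let γ : ℂ → Fin (2 * n + 1) → ℂ := fun t =>
      v + (t • Pi.single (mid n) 1 + b t • Pi.single k 1)
    have hγ : Continuous γ := by fun_prop
    have hmk : mid n ≠ k.rev := fun h => hk (by rw [← Fin.rev_rev k, ← h, rev_mid])
    have := eval_curve_eq_zero f hγ (F := {0, -2 * v (mid n)}) (by simp) (fun t ht => by
      refine hf _ ?_ (fun s hs => ?_) ?_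
      · have hQm : Q n (Pi.single (mid n) 1) = 1 := by
          rw [Q_eq_bil, bil_single_left, rev_mid, Pi.single_eq_same]
        rw [Q_add, Q_add, Q_smul, Q_smul, Q_single hk, hQ, hQm, bil_add_right, bil_smul_right,
          bil_smul_right, bil_smul_left, bil_smul_right, bil_single_right, bil_single_right,
          bil_single_right, rev_mid, Pi.single_eq_of_ne hmk.symm]
        simp only [b]
        field_simp
        ring
      · have h1 : s ≠ k := by rintro rfl; exact hs hkI
        have h2 : s ≠ mid n := by rintro rfl; exact hs hmI
        simp [γ, hv s hs, h1, h2]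
      · simp only [Set.mem_insert_iff, Set.mem_singleton_iff, not_or] at ht
        have h3 : t ^ 2 + 2 * t * v (mid n) ≠ 0 := by
          intro h
          have : t * (t + 2 * v (mid n)) = 0 := by linear_combination h
          rcases mul_eq_zero.1 this with h | h
          · exact ht.1 h
          · exact ht.2 (by linear_combination h)
        have h4 : γ t k = b t := by simp [γ, hvk, hk]
        rw [h4]
        exact div_ne_zero (neg_ne_zero.2 h3) (mul_ne_zero two_ne_zero hvr)) 0
    simpa [γ, b] using this

/-- The section is closed and contains the orbit; the orbit contains the dense part where the `k`-th
coordinate is nonzero. -/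
theorem zariskiClosure_orbit {H : Subgroup (Matrix.SpecialLinearGroup (Fin (2 * n + 1)) ℂ)}
    {I : Set (Fin (2 * n + 1))} {k : Fin (2 * n + 1)} (hkI : k ∈ I)
    (hk : k ≠ mid n) (hmid : k.rev ∈ I → mid n ∈ I) (hH : H ≤ SO n)
    (hHI : ∀ g ∈ H, ∀ s ∉ I, g.1 s k = 0)
    (horb : ∀ (v : Fin (2 * n + 1) → ℂ) (hv0 : v ≠ 0), v k ≠ 0 → Q n v = 0 → (∀ s ∉ I, v s = 0) →
      Projectivization.mk ℂ v hv0 ∈ MulAction.orbit H (basisPoint n k)) :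
    zariskiClosure (MulAction.orbit H (basisPoint n k)) = coordSection n I := by
  have hsub : MulAction.orbit H (basisPoint n k) ⊆ coordSection n I := by
    rintro _ ⟨g, rfl⟩
    change g.1 • basisPoint n k ∈ _
    rw [smul_basisPoint g.1 k (col_ne_zero _ _), mk_mem_coordSection]
    refine ⟨?_, fun s hs => hHI g.1 g.2 s hs⟩
    rw [← Matrix.mulVec_single_one, Q_mulVec (hH g.2), Q_single hk]
  apply Set.Subset.antisymm
  · intro p hp
    refine ⟨?_, fun s hs => ?_⟩
    · let q : MvPolynomial (Fin (2 * n + 1)) ℂ :=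
        ∑ s, MvPolynomial.X s * MvPolynomial.X (Fin.rev s)
      have hq : ∀ x, MvPolynomial.eval x q = Q n x := by
        intro x
        simp [q, Q_eq_sum]
      have hhom : q.IsHomogeneous 2 := MvPolynomial.IsHomogeneous.sum _ _ _ fun s _ =>
        (MvPolynomial.isHomogeneous_X ℂ s).mul (MvPolynomial.isHomogeneous_X ℂ s.rev)
      have := hp 2 q hhom fun y hy => by rw [hq]; exact (hsub hy).1
      rwa [hq] at this
    · have := hp 1 (MvPolynomial.X s) (MvPolynomial.isHomogeneous_X ℂ s) fun y hy => by
        rw [MvPolynomial.eval_X]; exact (hsub hy).2 s hs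
      rwa [MvPolynomial.eval_X] at this
  · intro p hp d f hf hfv
    refine eval_eq_zero_of_open_part hkI hk hmid (fun v hQ hv hvk => ?_) hp.1 hp.2
    have hv0 : v ≠ 0 := by rintro rfl; exact hvk rfl
    exact (eval_rep_mk_eq_zero_iff hf hv0).1 (hfv _ (horb v hv0 hvk hQ hv))

/-! ### Schubert varieties as coordinate sections -/

theorem X_eq_coordSection (n i : ℕ) :
    X n i = coordSection n {s : Fin (2 * n + 1) | (s : ℕ) + 1 ≤ i} := by
  ext p
  simp [X, coordSection]

theorem Xop_eq_coordSection (n j : ℕ) :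
    Xop n j = coordSection n {s : Fin (2 * n + 1) | j ≤ (s : ℕ) + 1} := by
  ext p
  simp [Xop, coordSection]

theorem zariskiClosure_orbit_borel {k : Fin (2 * n + 1)} (hk : k ≠ mid n) :
    zariskiClosure (MulAction.orbit (borel n) (basisPoint n k)) = X n ((k : ℕ) + 1) := by
  rw [X_eq_coordSection]
  refine zariskiClosure_orbit (by simp) hk ?_ inf_le_left ?_ ?_
  · simp only [Set.mem_ofPred_eq, Fin.val_rev, mid]
    omega
  · intro g hg s hs
    refine hg.2 (?_ : k < s)
    simp only [Set.mem_ofPred_eq] at hs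
    rw [Fin.lt_def]
    omega
  · intro v hv0 hvk hvQ hv
    refine mem_orbit_borel hk hv0 hvk hvQ fun r hr => hv r ?_
    simp only [Set.mem_ofPred_eq]
    rw [Fin.lt_def] at hr
    omega

theorem zariskiClosure_orbit_oppBorel {k : Fin (2 * n + 1)} (hk : k ≠ mid n) :
    zariskiClosure (MulAction.orbit (oppBorel n) (basisPoint n k)) = Xop n ((k : ℕ) + 1) := by
  rw [Xop_eq_coordSection]
  refine zariskiClosure_orbit (by simp) hk ?_ inf_le_left ?_ ?_
  · simp only [Set.mem_ofPred_eq, Fin.val_rev, mid]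
    omega
  · intro g hg s hs
    refine hg.2 (?_ : s < k)
    simp only [Set.mem_ofPred_eq] at hs
    rw [Fin.lt_def]
    omega
  · intro v hv0 hvk hvQ hv
    refine mem_orbit_oppBorel hk hv0 hvk hvQ fun r hr => hv r ?_
    simp only [Set.mem_ofPred_eq]
    rw [Fin.lt_def] at hr
    omega

/-! ### Singular loci of Schubert varieties -/

theorem schubert_linear {i : ℕ} (hi : i < n + 1) :
    Sing (X n i) = ∅ ∧ ∀ p ∈ X n i, HasMultiplicity (X n i) p 1 := by
  have hI : ∀ s ∈ {s : Fin (2 * n + 1) | (s : ℕ) + 1 ≤ i},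
      s.rev ∉ {s : Fin (2 * n + 1) | (s : ℕ) + 1 ≤ i} := by
    intro s hs
    simp only [Set.mem_ofPred_eq, Fin.val_rev] at hs ⊢
    omega
  rw [X_eq_coordSection]
  exact ⟨sing_coordSection_linear hI, fun p hp => (hasMultiplicity_coordSection_linear hI hp).1⟩

theorem oppSchubert_linear {j : ℕ} (hj : n + 1 < j) :
    Sing (Xop n j) = ∅ ∧ ∀ p ∈ Xop n j, HasMultiplicity (Xop n j) p 1 := by
  have hI : ∀ s ∈ {s : Fin (2 * n + 1) | j ≤ (s : ℕ) + 1},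
      s.rev ∉ {s : Fin (2 * n + 1) | j ≤ (s : ℕ) + 1} := by
    intro s hs
    simp only [Set.mem_ofPred_eq, Fin.val_rev] at hs ⊢
    omega
  rw [Xop_eq_coordSection]
  exact ⟨sing_coordSection_linear hI, fun p hp => (hasMultiplicity_coordSection_linear hI hp).1⟩

theorem coordsVanish_iff_schubert {i : ℕ} (p : PSpace n) :
    (∀ s ∈ {s : Fin (2 * n + 1) | (s : ℕ) + 1 ≤ i},
      s.rev ∈ {s : Fin (2 * n + 1) | (s : ℕ) + 1 ≤ i} → p.rep s = 0) ↔
      CoordsVanish n (2 * n + 2 - i) i p := by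
  simp only [Set.mem_ofPred_eq, Fin.val_rev, CoordsVanish]
  refine forall_congr' fun s => ⟨fun h h1 h2 => h h2 (by omega), fun h h1 h2 => h (by omega) h1⟩

theorem coordsVanish_iff_oppSchubert {j : ℕ} (p : PSpace n) :
    (∀ s ∈ {s : Fin (2 * n + 1) | j ≤ (s : ℕ) + 1},
      s.rev ∈ {s : Fin (2 * n + 1) | j ≤ (s : ℕ) + 1} → p.rep s = 0) ↔
      CoordsVanish n j (2 * n + 2 - j) p := by
  simp only [Set.mem_ofPred_eq, Fin.val_rev, CoordsVanish]
  refine forall_congr' fun s => ⟨fun h h1 h2 => h h1 (by omega), fun h h1 h2 => h h1 (by omega)⟩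

theorem schubert_quadratic (hn : 1 ≤ n) {i : ℕ} (hi : n + 1 < i) (hi' : i ≤ 2 * n + 1) :
    Sing (X n i) = X n (2 * n + 1 - i) ∧
      ∀ p ∈ X n i,
        (HasMultiplicity (X n i) p 2 ↔ CoordsVanish n (2 * n + 2 - i) i p) ∧
        (HasMultiplicity (X n i) p 1 ↔ ¬ CoordsVanish n (2 * n + 2 - i) i p) := by
  have hI : ∀ s : Fin (2 * n + 1), n ≤ (s : ℕ) + 1 → (s : ℕ) ≤ n + 1 →
      s ∈ {s : Fin (2 * n + 1) | (s : ℕ) + 1 ≤ i} := by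
    intro s h1 h2
    simp only [Set.mem_ofPred_eq]
    omega
  refine ⟨?_, fun p hp => ?_⟩
  · ext p
    rw [X_eq_coordSection n i, mem_sing_coordSection_iff hn hI, coordsVanish_iff_schubert,
      X_eq_coordSection]
    constructor
    · rintro ⟨⟨h1, h2⟩, h3⟩
      refine ⟨h1, fun s hs => ?_⟩
      simp only [Set.mem_ofPred_eq] at hs
      by_cases h : (s : ℕ) + 1 ≤ i
      · exact h3 s (by omega) h
      · exact h2 s h
    · rintro ⟨h1, h2⟩
      simp only [Set.mem_ofPred_eq] at h2
      exact ⟨⟨h1, fun s hs => h2 s (by simp only [Set.mem_ofPred_eq] at hs; omega)⟩,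
        fun s h3 h4 => h2 s (by omega)⟩
  · rw [X_eq_coordSection] at hp ⊢
    rw [← coordsVanish_iff_schubert]
    exact ⟨hasMultiplicity_two_iff hn hI hp, hasMultiplicity_one_iff hn hI hp⟩

theorem oppSchubert_quadratic (hn : 1 ≤ n) {j : ℕ} (hj : 1 ≤ j) (hj' : j < n + 1) :
    Sing (Xop n j) = Xop n (2 * n + 3 - j) ∧
      ∀ p ∈ Xop n j,
        (HasMultiplicity (Xop n j) p 2 ↔ CoordsVanish n j (2 * n + 2 - j) p) ∧
        (HasMultiplicity (Xop n j) p 1 ↔ ¬ CoordsVanish n j (2 * n + 2 - j) p) := by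
  have hI : ∀ s : Fin (2 * n + 1), n ≤ (s : ℕ) + 1 → (s : ℕ) ≤ n + 1 →
      s ∈ {s : Fin (2 * n + 1) | j ≤ (s : ℕ) + 1} := by
    intro s h1 h2
    simp only [Set.mem_ofPred_eq]
    omega
  refine ⟨?_, fun p hp => ?_⟩
  · ext p
    rw [Xop_eq_coordSection n j, mem_sing_coordSection_iff hn hI, coordsVanish_iff_oppSchubert,
      Xop_eq_coordSection]
    constructor
    · rintro ⟨⟨h1, h2⟩, h3⟩
      refine ⟨h1, fun s hs => ?_⟩
      simp only [Set.mem_ofPred_eq] at hs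
      by_cases h : j ≤ (s : ℕ) + 1
      · exact h3 s h (by omega)
      · exact h2 s h
    · rintro ⟨h1, h2⟩
      simp only [Set.mem_ofPred_eq] at h2
      exact ⟨⟨h1, fun s hs => h2 s (by simp only [Set.mem_ofPred_eq] at hs; omega)⟩,
        fun s h3 h4 => h2 s (by omega)⟩
  · rw [Xop_eq_coordSection] at hp ⊢
    rw [← coordsVanish_iff_oppSchubert]
    exact ⟨hasMultiplicity_two_iff hn hI hp, hasMultiplicity_one_iff hn hI hp⟩

theorem sing_inter_sing_eq_empty (hn : 1 ≤ n) {i j : ℕ} (hi : i ≤ 2 * n + 1)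
    (hin : i ≠ n + 1) (hj : 1 ≤ j) (hjn : j ≠ n + 1) :
    Sing (X n i) ∩ Sing (Xop n j) = ∅ := by
  rcases lt_or_gt_of_ne hin with h | h
  · rw [(schubert_linear h).1, Set.empty_inter]
  rcases lt_or_gt_of_ne hjn with h' | h'
  swap
  · rw [(oppSchubert_linear h').1, Set.inter_empty]
  rw [(schubert_quadratic hn h hi).1, (oppSchubert_quadratic hn hj h').1]
  -- One singular locus lives on coordinates before the middle and the other on coordinates after
  -- it, so a common point would have all coordinates zero.
  refine Set.eq_empty_of_forall_notMem fun p ⟨h1, h2⟩ => p.rep_nonzero (funext fun s => ?_)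
  by_cases hs : (s : ℕ) + 1 ≤ 2 * n + 1 - i
  · exact h2.2 s (by omega)
  · exact h1.2 s (by omega)

end OddQuadric

end

open OddQuadric in
theorem mainTheorem2 (n : ℕ) (hn : 1 ≤ n) :
    -- the quotient by `P_1` is the odd quadric
    Set.BijOn (quotientMap n) Set.univ (quadric n) ∧
    -- the torus-fixed points are the `[e_i]` with `i ≠ n + 1`
    torusFixedPoints n = {p | ∃ k : Fin (2 * n + 1), (k : ℕ) + 1 ≠ n + 1 ∧ p = basisPoint n k} ∧
    -- the Schubert varieties and the opposite Schubert varieties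
    (∀ k : Fin (2 * n + 1), (k : ℕ) + 1 ≠ n + 1 →
      zariskiClosure (MulAction.orbit (borel n) (basisPoint n k)) = X n ((k : ℕ) + 1) ∧
      zariskiClosure (MulAction.orbit (oppBorel n) (basisPoint n k)) = Xop n ((k : ℕ) + 1)) ∧
    -- singularities of the Schubert varieties
    (∀ i : ℕ, 1 ≤ i → i < n + 1 →
      Sing (X n i) = ∅ ∧ ∀ p ∈ X n i, HasMultiplicity (X n i) p 1) ∧
    (∀ i : ℕ, n + 1 < i → i ≤ 2 * n + 1 →
      Sing (X n i) = X n (2 * n + 1 - i) ∧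
      ∀ p ∈ X n i,
        (HasMultiplicity (X n i) p 2 ↔ CoordsVanish n (2 * n + 2 - i) i p) ∧
        (HasMultiplicity (X n i) p 1 ↔ ¬ CoordsVanish n (2 * n + 2 - i) i p)) ∧
    -- singularities of the opposite Schubert varieties
    (∀ j : ℕ, 1 ≤ j → j < n + 1 →
      Sing (Xop n j) = Xop n (2 * n + 3 - j) ∧
      ∀ p ∈ Xop n j,
        (HasMultiplicity (Xop n j) p 2 ↔ CoordsVanish n j (2 * n + 2 - j) p) ∧
        (HasMultiplicity (Xop n j) p 1 ↔ ¬ CoordsVanish n j (2 * n + 2 - j) p)) ∧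
    (∀ j : ℕ, n + 1 < j → j ≤ 2 * n + 1 →
      Sing (Xop n j) = ∅ ∧ ∀ p ∈ Xop n j, HasMultiplicity (Xop n j) p 1) ∧
    -- the singular loci are disjoint
    (∀ i j : ℕ, 1 ≤ i → i ≤ 2 * n + 1 → i ≠ n + 1 → 1 ≤ j → j ≤ 2 * n + 1 → j ≠ n + 1 →
      Sing (X n i) ∩ Sing (Xop n j) = ∅) := by
  have hmid : ∀ k : Fin (2 * n + 1), (k : ℕ) + 1 ≠ n + 1 ↔ k ≠ mid n := by
    intro k
    simp only [Ne, Fin.ext_iff, mid]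
    omega
  refine ⟨bijOn_quotientMap hn, ?_, fun k hk => ?_, fun i _ hi => schubert_linear hi,
    fun i hi hi' => schubert_quadratic hn hi hi', fun j hj hj' => oppSchubert_quadratic hn hj hj',
    fun j hj _ => oppSchubert_linear hj,
    fun i j _ hi hin hj _ hjn => sing_inter_sing_eq_empty hn hi hin hj hjn⟩
  · simp only [hmid]
    exact torusFixedPoints_eq hn
  · rw [hmid] at hk
    exact ⟨zariskiClosure_orbit_borel hk, zariskiClosure_orbit_oppBorel hk⟩
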